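/- For positive integers $m,A,B$ let $\mathcal N(m,A,B)$ be the number of $A$-element subsets of $\{1,\dots,m\}$ whose elements sum to $B$. For $\alpha\ge 2$, the number of magic series of $\alpha$-hypercubes of order $N$ is $\mathcal N_\alpha(N)=\mathcal N\big(N^\alpha,N,\tfrac12N(N^\alpha+1)\big)$, where $\tfrac12N(N^\alpha+1)=N^{-(\alpha-1)}\sum_{i=1}^{N^\alpha}i$ is the magic sum. Let $P^*(m,\beta)$ be the probability that, when each element of $\{1,\dots,m\}$ is selected independently with probability $\beta$, the number and the total of the selected elements both equal their means $\beta m$ and $\tfrac12\beta m(m+1)$, and let $$P^*_g(m,\beta)=\frac{1}{\pi\beta(1-\beta)m}\sqrt{\frac{3}{m^2-1}}$$ be its Gaussian approximation. Let $$\mathcal N_{\alpha,g}(N)=\beta^{-\beta m}(1-\beta)^{-(1-\beta)m}P_g^*(m,\beta),\qquad m=N^\alpha,\ \beta=N^{-(\alpha-1)},$$ be the Gaussian approximation of $\mathcal N_\alpha(N)$. Finally let $$K_1=-\frac{V_{abc}V_{def}}{72}\langle k_ak_bk_ck_dk_ek_f\rangle+\frac{V_{abcd}}{24}\langle k_ak_bk_ck_d\rangle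 ,$$ where the indices take the values $x,y$ and repeated indices are summed, $V_{abc\dots}=1/(1+n_y)$ with $n_y$ the number of indices equal to $y$, and $\langle\cdot\rangle$ is the expectation under the centered Gaussian distribution on $\mathbb R^2$ with covariance matrix $\begin{pmatrix}1&1/2\\1/2&1/3\end{pmatrix}^{-1}=\begin{pmatrix}4&-6\\-6&12\end{pmatrix}$. Then the following hold. 1. As $N\to\infty$, $$\mathcal N_4(N)=\frac{\sqrt3}{\pi}\,\frac{(N^3e)^N}{N^5}\left(1-\frac{7}{30N}-\frac{1249}{2520N^2}+O\!\left(\frac1{N^3}\right)\right).$$ 2. For every fixed integer $\alpha>4$, as $N\to\infty$, $$\mathcal N_\alpha(N)=\frac{\sqrt3}{\pi}\,\frac{(N^{\alpha-1}e)^N}{N^{\alpha+1}}\left(1-\frac{7}{30N}+\frac{11}{2520N^2}+O_\alpha\!\left(\frac1{N^3}\right)\right).$$ 3. $K_1=-\frac{7}{30}$, and $K_1$ is universal: along every sequence of pairs $(m,\beta)$ with $m\in\mathbb N$, $\beta\to0$ and $\beta m\to\infty$ such that $\beta m$ and $\tfrac12\beta m(m+1)$ are integers, $$\frac{P^*(m,\beta)}{P^*_g(m,\beta)}=1+\frac{K_1}{\beta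 m}+o\!\left(\frac1{\beta m}\right).$$ In particular the first correction factor is the same for hypercubes of every order: for every fixed integer $\alpha\ge2$, as $N\to\infty$, $$\frac{\mathcal N_\alpha(N)}{\mathcal N_{\alpha,g}(N)}=1+\frac{K_1}{N}+O_\alpha\!\left(\frac1{N^2}\right)=1-\frac{7}{30N}+O_\alpha\!\left(\frac1{N^2}\right).$$ -/

import Mathlib

open Filter Topology Asymptotics

noncomputable section

namespace MagicSeries

/-- `𝒩(m, A, B)`: the number of subsets of `{1, …, m}` that have `A` elements and sum to `B`. -/
def subsetCount (m A B : ℕ) : ℕ :=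
  (((Finset.Icc 1 m).powersetCard A).filter (fun S => ∑ i ∈ S, i = B)).card

/-- The magic sum `(1 / N^(α-1)) * ∑_{i=1}^{N^α} i` of a normal magic `α`-hypercube of order `N`.
The division in `ℕ` is exact for `1 ≤ α`, `1 ≤ N`, see `pow_mul_magicSum`. -/
def magicSum (α N : ℕ) : ℕ :=
  (∑ i ∈ Finset.Icc 1 (N ^ α), i) / N ^ (α - 1)

/-- `𝒩_α(N)`: the number of magic series of `α`-hypercubes of order `N`, that is, of `N`-element
subsets of `{1, …, N^α}` whose sum is the magic sum. -/
def magicSeriesCount (α N : ℕ) : ℕ :=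
  subsetCount (N ^ α) N (magicSum α N)

/-- The probability that `A` numbers with total `B` are selected, when each element of `{1, …, m}`
is selected independently with probability `β`. The arguments `A`, `B` are real, because they will
be the means of the number and of the total of the selected elements. -/
def selectionProb (m : ℕ) (β A B : ℝ) : ℝ :=
  ∑ S ∈ (Finset.Icc 1 m).powerset.filter
      (fun S : Finset ℕ => (S.card : ℝ) = A ∧ ∑ i ∈ S, (i : ℝ) = B),
    β ^ S.card * (1 - β) ^ (m - S.card)

/-- The central probability `P*(m, β)`: number and total both take their mean values
`β m` and `β m (m + 1) / 2`. -/
def centralProb (m : ℕ) (β : ℝ) : ℝ :=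
  selectionProb m β (β * m) (β * m * (m + 1) / 2)

/-- The Gaussian approximation `P*_g(m, β) = 1 / (2 π √(det Σ))` of the central probability, where
`Σ` is the covariance matrix of number and total; see `two_pi_mul_sqrt_det_covMatrix`. -/
def gaussianCentralProb (m : ℕ) (β : ℝ) : ℝ :=
  1 / (Real.pi * β * (1 - β) * m) * Real.sqrt (3 / ((m : ℝ) ^ 2 - 1))

/-- The Gaussian approximation of the number `𝒩_α(N)`: with `m = N^α` and `β = 1 / N^(α-1)`, it is
`β^(-β m) (1-β)^(-(1-β) m) P*_g(m, β)`. -/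
def gaussianCount (α N : ℕ) : ℝ :=
  let m : ℝ := (N : ℝ) ^ α
  let β : ℝ := 1 / (N : ℝ) ^ (α - 1)
  β ^ (-(β * m)) * (1 - β) ^ (-((1 - β) * m)) * gaussianCentralProb (N ^ α) β

/-- The limit as `m → ∞` of the rescaled covariance matrix. The index `0` stands for `x` (number),
the index `1` for `y` (total). -/
def covLimit : Matrix (Fin 2) (Fin 2) ℝ := !![1, 1 / 2; 1 / 2, 1 / 3]

/-- Expectation with respect to the normalized centered Gaussian distribution on `ℝ²` with
covariance matrix `covLimit⁻¹`, i.e. with density proportional to `exp (-(k ⬝ covLimit k) / 2)`. -/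
def gaussianMean (f : (Fin 2 → ℝ) → ℝ) : ℝ :=
  (∫ k : Fin 2 → ℝ, f k * Real.exp (-(k ⬝ᵥ covLimit.mulVec k) / 2)) /
    ∫ k : Fin 2 → ℝ, Real.exp (-(k ⬝ᵥ covLimit.mulVec k) / 2)

/-- The rescaled vertex `V_{abc…} = 1 / (1 + n_y)`, where `n_y` is the number of indices equal
to `y`. -/
def vertex {r : ℕ} (a : Fin r → Fin 2) : ℝ :=
  1 / (1 + ((Finset.univ.filter (fun i => a i = 1)).card : ℝ))

/-- The first correction coefficient
`K₁ = -(V_{abc} V_{def} / 72) ⟨k_a k_b k_c k_d k_e k_f⟩ + (V_{abcd} / 24) ⟨k_a k_b k_c k_d⟩`,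
with summation over repeated indices. -/
def K₁ : ℝ :=
  -(∑ a : Fin 3 → Fin 2, ∑ b : Fin 3 → Fin 2,
      vertex a * vertex b / 72 * gaussianMean (fun k => (∏ i, k (a i)) * ∏ i, k (b i)))
    + ∑ a : Fin 4 → Fin 2, vertex a / 24 * gaussianMean (fun k => ∏ i, k (a i))

theorem two_mul_sum_Icc (n : ℕ) : 2 * ∑ i ∈ Finset.Icc 1 n, i = n * (n + 1) := by
  induction n with
  | zero => simp
  | succ k ih => rw [Finset.sum_Icc_succ_top (by omega), mul_add, ih]; ring

theorem two_mul_magicSum {α N : ℕ} (hα : 1 ≤ α) (hN : 1 ≤ N) :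
    2 * magicSum α N = N * (N ^ α + 1) := by
  have hp : 0 < N ^ (α - 1) := by positivity
  have hs : N ^ α = N ^ (α - 1) * N := by
    rw [← pow_succ, Nat.sub_add_cancel hα]
  have he : Even (N * (N ^ α + 1)) := by
    rcases Nat.even_or_odd N with h | h
    · exact h.mul_right _
    · exact (h.pow.add_odd odd_one).mul_left _
  obtain ⟨t, ht⟩ := he
  have hsum : ∑ i ∈ Finset.Icc 1 (N ^ α), i = N ^ (α - 1) * t := by
    have h2 : 2 * ∑ i ∈ Finset.Icc 1 (N ^ α), i = 2 * (N ^ (α - 1) * t) := by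
      rw [two_mul_sum_Icc]
      calc N ^ α * (N ^ α + 1) = N ^ (α - 1) * (N * (N ^ α + 1)) := by
            rw [← mul_assoc, ← hs]
        _ = 2 * (N ^ (α - 1) * t) := by rw [ht]; ring
    omega
  rw [magicSum, hsum, Nat.mul_div_cancel_left _ hp, ht]
  ring

theorem pow_mul_magicSum {α N : ℕ} (hα : 1 ≤ α) (hN : 1 ≤ N) :
    N ^ (α - 1) * magicSum α N = ∑ i ∈ Finset.Icc 1 (N ^ α), i := by
  have hs : N ^ α = N ^ (α - 1) * N := by
    rw [← pow_succ, Nat.sub_add_cancel hα]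
  have h1 := two_mul_magicSum hα hN
  have h2 := two_mul_sum_Icc (N ^ α)
  have h3 : 2 * (N ^ (α - 1) * magicSum α N) = 2 * ∑ i ∈ Finset.Icc 1 (N ^ α), i := by
    rw [h2]
    calc 2 * (N ^ (α - 1) * magicSum α N) = N ^ (α - 1) * (2 * magicSum α N) := by ring
      _ = N ^ α * (N ^ α + 1) := by rw [h1, ← mul_assoc, ← hs]
  omega

/-- The covariance matrix of number and total of the selected elements. -/
def covMatrix (m : ℕ) (β : ℝ) : Matrix (Fin 2) (Fin 2) ℝ :=
  !![β * (1 - β) * m, β * (1 - β) * m * (m + 1) / 2;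
     β * (1 - β) * m * (m + 1) / 2, β * (1 - β) * m * (m + 1) * (2 * m + 1) / 6]

theorem two_pi_mul_sqrt_det_covMatrix (m : ℕ) (β : ℝ) (h0 : 0 < β) (h1 : β < 1) :
    gaussianCentralProb m β = 1 / (2 * Real.pi * Real.sqrt (covMatrix m β).det) := by
  have hd : (covMatrix m β).det = (β * (1 - β) * m / 2) ^ 2 * (((m : ℝ) ^ 2 - 1) / 3) := by
    rw [covMatrix, Matrix.det_fin_two_of]; ring
  have hb : 0 ≤ β * (1 - β) * m / 2 := by
    have : 0 < 1 - β := by linarith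
    positivity
  rw [hd, Real.sqrt_mul (sq_nonneg _), Real.sqrt_sq hb, gaussianCentralProb,
    show (3 : ℝ) / ((m : ℝ) ^ 2 - 1) = (((m : ℝ) ^ 2 - 1) / 3)⁻¹ by rw [inv_div],
    Real.sqrt_inv]
  simp only [one_div, ← mul_inv]
  congr 1
  ring

end MagicSeries

end

/-!
The number of `A`-element subsets of `{1, …, m}` with the central sum `A (m + 1) / 2` is the central
coefficient of a Gaussian binomial coefficient, so it is a one-dimensional Fourier integral of
`∏ sin ((m - i) t) / sin ((i + 1) t)`, the product running over `0 ≤ i < A`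
(`subsetCount_eq_integral`, `centeredGen_mul_prod_sin`). Fixing the number of elements exactly leaves
only the total to be analysed; the number itself contributes a binomial probability.

On `|t| ≤ 2 / m` the logarithm of the product is expanded by means of
`-log sinc x = x ^ 2 / 6 + x ^ 4 / 180 + x ^ 6 / 2835 + O(x ^ 8)`. The quadratic part is kept exactly, and
the rest gives an Edgeworth expansion (`abs_centralIntegral_sub_le`), which yields the factor
`1 - 3 / (20 A) - 13 / (1120 A ^ 2)`. The remaining `t` are negligible by Cauchy's estimate for
elementary symmetric polynomials: when all variables have modulus one, their size is governed by the
first power sum, here a geometric sum (`norm_esymm_mul_pow_le`). This bound is uniform in the ratio of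
`A` to `log m`, which is why no growth condition beyond `A → ∞`, `A / m → 0` is needed.

Stirling's formula contributes `1 - 1 / (12 A) + 1 / (288 A ^ 2)` for the number of elements. The product
of the two factors is `1 - 7 / (30 A) + 11 / (2520 A ^ 2)`, with error `O(1 / A ^ 3 + 1 / m)`, uniformly
(`hasExpansion_ratio`). All asymptotic claims follow from this expansion: for hypercubes
`A = N` and `m = N ^ α`, and the elementary approximation of the Gaussian count brings in the further
factor `1 - 1 / (2 N ^ 2)` exactly when `α = 4`. The value of `K₁` is a Gaussian moment computation
(`K₁_eq`), where a shear diagonalises the quadratic form.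
-/

noncomputable section

namespace MagicSeries

/-! ### Fourier inversion and the Gaussian binomial coefficient -/

/-- Orthogonality of the characters `exp (2 i k t)` on an interval of length `π`. -/
theorem integral_exp_two_mul_int (k : ℤ) :
    ∫ t in -(Real.pi / 2)..(Real.pi / 2), Complex.exp (Complex.I * ((t * (2 * k) : ℝ) : ℂ)) =
      if k = 0 then (Real.pi : ℂ) else 0 := by
  split_ifs with hk
  · subst hk
    simp
  · have hc : (2 * k * Complex.I : ℂ) ≠ 0 := by
      simp [hk, Complex.I_ne_zero]
    have h1 : ∀ t : ℝ, Complex.exp (Complex.I * ((t * (2 * k) : ℝ) : ℂ)) =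
        Complex.exp ((2 * k * Complex.I) * (t : ℂ)) := by
      intro t; congr 1; push_cast; ring
    simp_rw [h1]
    rw [integral_exp_mul_complex hc]
    have h2 : Complex.exp (2 * k * Complex.I * ((Real.pi / 2 : ℝ) : ℂ)) =
        Complex.exp (2 * k * Complex.I * ((-(Real.pi / 2) : ℝ) : ℂ)) := by
      rw [Complex.exp_eq_exp_iff_exists_int]
      exact ⟨k, by push_cast; ring⟩
    rw [h2, sub_self, zero_div]

/-- The characteristic function of the centred subset sum, up to normalisation: the sum of
`exp (i t (2 ∑ S - A (m + 1)))` over all `A`-element subsets `S` of `{1, …, m}`. Up to a power of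
`q` it is the Gaussian binomial coefficient at `q = exp (2 i t)`. -/
def centeredGen (m A : ℕ) (t : ℝ) : ℂ :=
  ∑ S ∈ (Finset.Icc 1 m).powersetCard A,
    Complex.exp (Complex.I * ((t * (2 * ((∑ i ∈ S, i : ℕ) : ℝ) - A * (m + 1)) : ℝ) : ℂ))

theorem continuous_centeredGen (m A : ℕ) : Continuous (centeredGen m A) := by
  unfold centeredGen
  fun_prop

theorem subsetCount_eq_integral {m A B : ℕ} (h : 2 * B = A * (m + 1)) :
    (subsetCount m A B : ℂ) =
      1 / Real.pi * ∫ t in -(Real.pi / 2)..(Real.pi / 2), centeredGen m A t := by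
  unfold centeredGen
  rw [intervalIntegral.integral_finsetSum
    (fun S _ => (by fun_prop : Continuous _).intervalIntegrable _ _)]
  have h1 : ∀ S : Finset ℕ, (∫ t in -(Real.pi / 2)..(Real.pi / 2),
      Complex.exp (Complex.I * ((t * (2 * ((∑ i ∈ S, i : ℕ) : ℝ) - A * (m + 1)) : ℝ) : ℂ))) =
      if ∑ i ∈ S, i = B then (Real.pi : ℂ) else 0 := by
    intro S
    have h2 := integral_exp_two_mul_int ((∑ i ∈ S, i : ℕ) - (B : ℤ))
    have h3 : (2 * ((∑ i ∈ S, i : ℕ) : ℝ) - A * (m + 1)) =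
        2 * (((((∑ i ∈ S, i : ℕ) : ℤ) - (B : ℤ) : ℤ)) : ℝ) := by
      have : (2 * B : ℝ) = A * (m + 1) := by exact_mod_cast h
      rw [← this]; push_cast; ring
    rw [h3, h2]
    congr 1
    simp only [eq_iff_iff]
    omega
  simp_rw [h1]
  rw [← Finset.sum_filter, Finset.sum_const, subsetCount, nsmul_eq_mul]
  have : (Real.pi : ℂ) ≠ 0 := by exact_mod_cast Real.pi_ne_zero
  field_simp

/-- The Pascal recursion: the subsets are split according to whether they contain `m + 1`. Both phases
come from the shift of the centre `A (m + 1) / 2`. -/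
theorem centeredGen_succ_succ (m A : ℕ) (t : ℝ) :
    centeredGen (m + 1) (A + 1) t =
      Complex.exp (Complex.I * ((t * (m - A) : ℝ) : ℂ)) * centeredGen m A t +
      Complex.exp (-(Complex.I * ((t * (A + 1) : ℝ) : ℂ))) * centeredGen m (A + 1) t := by
  have hnot : m + 1 ∉ Finset.Icc 1 m := by simp
  have hI : Finset.Icc 1 (m + 1) = insert (m + 1) (Finset.Icc 1 m) := by
    ext x; simp; omega
  unfold centeredGen
  rw [hI, Finset.powersetCard_succ_insert hnot, Finset.sum_union, add_comm, Finset.sum_image]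
  · rw [Finset.mul_sum, Finset.mul_sum]
    congr 1
    · refine Finset.sum_congr rfl fun S hS => ?_
      have hS' : m + 1 ∉ S := fun hm =>
        hnot ((Finset.mem_powersetCard.1 hS).1 hm)
      rw [Finset.sum_insert hS', ← Complex.exp_add]
      congr 1
      push_cast
      ring
    · refine Finset.sum_congr rfl fun S hS => ?_
      rw [← Complex.exp_add]
      congr 1
      push_cast
      ring
  · intro S hS T hT hST
    have h1 : m + 1 ∉ S := fun hm => hnot ((Finset.mem_powersetCard.1 hS).1 hm)
    have h2 : m + 1 ∉ T := fun hm => hnot ((Finset.mem_powersetCard.1 hT).1 hm)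
    have := congrArg (fun U => U.erase (m + 1)) hST
    simpa [Finset.erase_insert h1, Finset.erase_insert h2] using this
  · rw [Finset.disjoint_left]
    intro S hS hS'
    obtain ⟨T, -, rfl⟩ := Finset.mem_image.1 hS'
    exact hnot ((Finset.mem_powersetCard.1 hS).1 (Finset.mem_insert_self _ _))

/-- The product formula for the Gaussian binomial coefficient, in symmetric trigonometric form. -/
theorem centeredGen_mul_prod_sin (m A : ℕ) (t : ℝ) :
    centeredGen m A t * ((∏ i ∈ Finset.range A, Real.sin ((i + 1) * t) : ℝ) : ℂ) =
      ((∏ i ∈ Finset.range A, Real.sin ((m - i) * t) : ℝ) : ℂ) := by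
  induction m generalizing A with
  | zero =>
    cases A with
    | zero => simp [centeredGen]
    | succ A =>
      have h1 : centeredGen 0 (A + 1) t = 0 := by
        have : (∅ : Finset ℕ).powersetCard (A + 1) = ∅ :=
          Finset.powersetCard_eq_empty.2 (by simp)
        simp [centeredGen, this]
      have h2 : ∏ i ∈ Finset.range (A + 1), Real.sin ((((0 : ℕ) : ℝ) - i) * t) = 0 :=
        Finset.prod_eq_zero (Finset.mem_range.2 (Nat.succ_pos A)) (by simp)
      rw [h1, h2]; simp
  | succ m ih =>
    cases A with
    | zero => simp [centeredGen]
    | succ A =>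
      have ih1 := ih A
      have ih2 := ih (A + 1)
      rw [centeredGen_succ_succ]
      have h3 : ∏ i ∈ Finset.range (A + 1), Real.sin ((((m + 1 : ℕ) : ℝ) - i) * t) =
          (∏ i ∈ Finset.range A, Real.sin (((m : ℝ) - i) * t)) * Real.sin ((m + 1) * t) := by
        rw [Finset.prod_range_succ']
        push_cast
        simp
      rw [h3, add_mul, mul_assoc, mul_assoc, ih2]
      rw [Finset.prod_range_succ, Finset.prod_range_succ]
      push_cast at ih1 ⊢
      rw [← mul_assoc (centeredGen m A t), ih1]
      have key : Complex.sin ((m + 1) * t) =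
          Complex.exp (Complex.I * (t * (m - A))) * Complex.sin ((A + 1) * t) +
          Complex.exp (-(Complex.I * (t * (A + 1)))) * Complex.sin ((m - A) * t) := by
        have e1 : Complex.exp (Complex.I * (t * (m - A))) =
            Complex.cos ((m - A) * t) + Complex.sin ((m - A) * t) * Complex.I := by
          rw [← Complex.exp_mul_I]; congr 1; ring
        have e2 : Complex.exp (-(Complex.I * (t * (A + 1)))) =
            Complex.cos ((A + 1) * t) - Complex.sin ((A + 1) * t) * Complex.I := by
          have : -(Complex.I * (t * (A + 1))) = (-((A + 1) * t)) * Complex.I := by ring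
          rw [this, Complex.exp_mul_I, Complex.cos_neg, Complex.sin_neg]; ring
        have e3 : ((m : ℂ) + 1) * t = (m - A) * t + (A + 1) * t := by ring
        rw [e1, e2, e3, Complex.sin_add]
        ring
      rw [key]
      ring

theorem norm_one_add_le_exp (w : ℂ) : ‖1 + w‖ ≤ Real.exp (w.re + ‖w‖ ^ 2 / 2) := by
  refine le_of_sq_le_sq ?_ (Real.exp_pos _).le
  rw [← Real.exp_nat_mul, Complex.sq_norm, Complex.normSq_add]
  have h := Real.add_one_le_exp (((2 : ℕ) : ℝ) * (w.re + ‖w‖ ^ 2 / 2))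
  refine le_trans (le_of_eq ?_) h
  rw [Complex.sq_norm]
  simp
  ring

/-- Cauchy's estimate for the elementary symmetric polynomial of degree `A` of numbers of modulus
one. It is sharp enough to detect cancellation in the first power sum. -/
theorem norm_esymm_mul_pow_le (s : Finset ℕ) (x : ℕ → ℂ) (hx : ∀ j ∈ s, ‖x j‖ = 1) (A : ℕ)
    {r : ℝ} (hr : 0 ≤ r) :
    ‖∑ S ∈ s.powersetCard A, ∏ j ∈ S, x j‖ * r ^ A ≤
      Real.exp (r * ‖∑ j ∈ s, x j‖ + s.card * r ^ 2 / 2) := by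
  set M := Real.exp (r * ‖∑ j ∈ s, x j‖ + s.card * r ^ 2 / 2) with hM
  let z : ℝ → ℂ := fun t => r * Complex.exp (Complex.I * ((2 * t : ℝ) : ℂ))
  have hz : ∀ t, ‖z t‖ = r := by
    intro t
    simp only [z, norm_mul, Complex.norm_real, Real.norm_eq_abs, abs_of_nonneg hr]
    rw [mul_comm Complex.I, Complex.norm_exp_ofReal_mul_I, mul_one]
  have hbound : ∀ t, ‖∏ j ∈ s, (1 + z t * x j)‖ ≤ M := by
    intro t
    rw [norm_prod]
    calc ∏ j ∈ s, ‖1 + z t * x j‖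
        ≤ ∏ j ∈ s, Real.exp ((z t * x j).re + r ^ 2 / 2) := by
          refine Finset.prod_le_prod (fun _ _ => norm_nonneg _) fun j hj => ?_
          refine (norm_one_add_le_exp _).trans_eq ?_
          rw [norm_mul, hz, hx j hj, mul_one]
      _ = Real.exp ((z t * ∑ j ∈ s, x j).re + s.card * r ^ 2 / 2) := by
          rw [← Real.exp_sum, Finset.sum_add_distrib, Finset.mul_sum, Complex.re_sum,
            Finset.sum_const, nsmul_eq_mul]
          ring_nf
      _ ≤ M := by
          refine Real.exp_le_exp.2 (add_le_add_left ?_ _)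
          refine (Complex.re_le_norm _).trans_eq ?_
          rw [norm_mul, hz]
  have hint : ∫ t in -(Real.pi / 2)..(Real.pi / 2),
      (∏ j ∈ s, (1 + z t * x j)) * Complex.exp (Complex.I * ((t * (2 * (-(A : ℤ) : ℤ)) : ℝ) : ℂ))
      = Real.pi * (r ^ A * ∑ S ∈ s.powersetCard A, ∏ j ∈ S, x j) := by
    have h1 : ∀ t : ℝ, (∏ j ∈ s, (1 + z t * x j)) *
        Complex.exp (Complex.I * ((t * (2 * (-(A : ℤ) : ℤ)) : ℝ) : ℂ)) =
        ∑ S ∈ s.powerset, ((r : ℂ) ^ S.card * ∏ j ∈ S, x j) *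
          Complex.exp (Complex.I * ((t * (2 * ((S.card : ℤ) - A : ℤ)) : ℝ) : ℂ)) := by
      intro t
      rw [Finset.prod_one_add, Finset.sum_mul]
      refine Finset.sum_congr rfl fun S _ => ?_
      rw [Finset.prod_mul_distrib, Finset.prod_const]
      simp only [z]
      rw [mul_pow, ← Complex.exp_nat_mul]
      have : Complex.exp (Complex.I * ((t * (2 * ((S.card : ℤ) - A : ℤ)) : ℝ) : ℂ)) =
          Complex.exp (S.card * (Complex.I * ((2 * t : ℝ) : ℂ))) *
          Complex.exp (Complex.I * ((t * (2 * (-(A : ℤ) : ℤ)) : ℝ) : ℂ)) := by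
        rw [← Complex.exp_add]; congr 1; push_cast; ring
      rw [this]; ring
    simp_rw [h1]
    rw [intervalIntegral.integral_finsetSum
      (fun S _ => (by fun_prop : Continuous _).intervalIntegrable _ _)]
    simp_rw [intervalIntegral.integral_const_mul, integral_exp_two_mul_int]
    rw [← Finset.sum_subset (show s.powersetCard A ⊆ s.powerset from fun S hS =>
      Finset.mem_powerset.2 (Finset.mem_powersetCard.1 hS).1)]
    · rw [Finset.mul_sum, Finset.mul_sum]
      refine Finset.sum_congr rfl fun S hS => ?_
      rw [(Finset.mem_powersetCard.1 hS).2]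
      simp
      ring
    · intro S hS hS'
      have : ((S.card : ℤ) - A : ℤ) ≠ 0 := by
        intro h
        exact hS' (Finset.mem_powersetCard.2 ⟨Finset.mem_powerset.1 hS, by omega⟩)
      rw [if_neg this, mul_zero]
  have hle := intervalIntegral.norm_integral_le_of_norm_le_const (a := -(Real.pi / 2))
    (b := Real.pi / 2) (C := M) (f := fun t : ℝ => (∏ j ∈ s, (1 + z t * x j)) *
      Complex.exp (Complex.I * ((t * (2 * (-(A : ℤ) : ℤ)) : ℝ) : ℂ))) (by
      intro t _
      rw [norm_mul, mul_comm Complex.I, Complex.norm_exp_ofReal_mul_I, mul_one]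
      exact hbound t)
  rw [hint, norm_mul, norm_mul, norm_pow, Complex.norm_real, Complex.norm_real,
    Real.norm_of_nonneg Real.pi_pos.le, Real.norm_of_nonneg hr] at hle
  have : |Real.pi / 2 - -(Real.pi / 2)| = Real.pi := by
    rw [show Real.pi / 2 - -(Real.pi / 2) = Real.pi by ring, abs_of_pos Real.pi_pos]
  rw [this, mul_comm M] at hle
  have := le_of_mul_le_mul_left hle Real.pi_pos
  linarith

/-- The geometric sum bound for the first power sum of the numbers `exp (2 i j t)`. -/
theorem norm_sum_exp_mul_sin_le (m : ℕ) (t : ℝ) :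
    ‖∑ j ∈ Finset.Icc 1 m, Complex.exp (Complex.I * ((t * (2 * j) : ℝ) : ℂ))‖ *
      |Real.sin t| ≤ 1 := by
  have h : (∑ j ∈ Finset.Icc 1 m, Complex.exp (Complex.I * ((t * (2 * j) : ℝ) : ℂ))) *
      (2 * Complex.I * Complex.sin t) = Complex.exp (Complex.I * ((t * (2 * m + 1) : ℝ) : ℂ)) -
        Complex.exp (Complex.I * ((t : ℝ) : ℂ)) := by
    have hs : 2 * Complex.I * Complex.sin t =
        Complex.exp (Complex.I * t) - Complex.exp (-(Complex.I * t)) := by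
      rw [Complex.sin]
      have : Complex.I * Complex.I = -1 := Complex.I_mul_I
      have e : -(Complex.I * (t : ℂ)) = -t * Complex.I := by ring
      rw [e, mul_comm Complex.I (t : ℂ)]
      linear_combination
        (Complex.exp (-t * Complex.I) - Complex.exp (t * Complex.I)) * this
    rw [hs]
    induction m with
    | zero => simp
    | succ m ih =>
      rw [Finset.sum_Icc_succ_top (by omega), add_mul, ih, mul_sub, ← Complex.exp_add,
        ← Complex.exp_add]
      push_cast
      ring_nf
  have h2 := congrArg norm h
  rw [norm_mul, norm_mul, norm_mul, ← Complex.ofReal_sin, Complex.norm_real, Complex.norm_I,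
    Real.norm_eq_abs] at h2
  have h3 := norm_sub_le (Complex.exp (Complex.I * ((t * (2 * m + 1) : ℝ) : ℂ)))
    (Complex.exp (Complex.I * ((t : ℝ) : ℂ)))
  rw [mul_comm Complex.I, mul_comm Complex.I, Complex.norm_exp_ofReal_mul_I,
    Complex.norm_exp_ofReal_mul_I] at h3
  rw [mul_comm Complex.I, mul_comm Complex.I] at h2
  rw [← h2] at h3
  norm_num at h3
  simp_rw [mul_comm Complex.I] at h3 ⊢
  push_cast at h3 ⊢
  linarith

/-- Cauchy's estimate for the generating function, with the first power sum bounded by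
`1 / |sin t| ≤ P`. -/
theorem norm_centeredGen_mul_pow_le (m A : ℕ) (t : ℝ) {r P : ℝ} (hr : 0 ≤ r)
    (hP : 1 ≤ P * |Real.sin t|) :
    ‖centeredGen m A t‖ * r ^ A ≤ Real.exp (r * P + m * r ^ 2 / 2) := by
  set x : ℕ → ℂ := fun j => Complex.exp (Complex.I * ((t * (2 * j) : ℝ) : ℂ)) with hx
  have h1 : centeredGen m A t = Complex.exp (-(t * (A * (m + 1)) : ℝ) * Complex.I) *
      ∑ S ∈ (Finset.Icc 1 m).powersetCard A, ∏ j ∈ S, x j := by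
    rw [centeredGen, Finset.mul_sum]
    refine Finset.sum_congr rfl fun S _ => ?_
    simp only [hx]
    rw [← Complex.exp_sum, ← Complex.exp_add, ← Finset.mul_sum, ← Complex.ofReal_sum,
      ← Finset.mul_sum, ← Finset.mul_sum]
    congr 1
    push_cast
    ring
  have h2 := norm_esymm_mul_pow_le (Finset.Icc 1 m) x (fun j _ => by
    simp only [hx]; rw [mul_comm Complex.I, Complex.norm_exp_ofReal_mul_I]) A hr
  rw [h1, norm_mul, ← Complex.ofReal_neg, Complex.norm_exp_ofReal_mul_I, one_mul]
  refine h2.trans (Real.exp_le_exp.2 ?_)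
  have hs : 0 < |Real.sin t| := by
    rcases (abs_nonneg (Real.sin t)).eq_or_lt with h | h
    · rw [← h] at hP; norm_num at hP
    · exact h
  have h3 : ‖∑ j ∈ Finset.Icc 1 m, x j‖ ≤ P :=
    le_of_mul_le_mul_right ((norm_sum_exp_mul_sin_le m t).trans hP) hs
  simp only [Nat.card_Icc, Nat.add_sub_cancel]
  gcongr

open MeasureTheory

/-! ### Gaussian moments and the value of `K₁` -/

theorem integrable_pow_mul_exp_neg_mul_sq {b : ℝ} (hb : 0 < b) (k : ℕ) :
    Integrable fun x : ℝ => x ^ k * Real.exp (-b * x ^ 2) := by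
  have := integrable_rpow_mul_exp_neg_mul_sq hb (s := k) (by linarith [k.cast_nonneg (α := ℝ)])
  simpa only [Real.rpow_natCast] using this

/-- The even moments of the Gaussian weight `exp (-b x ^ 2)`. -/
theorem integral_pow_two_mul_mul_exp_neg_mul_sq {b : ℝ} (hb : 0 < b) (k : ℕ) :
    ∫ x : ℝ, x ^ (2 * k) * Real.exp (-b * x ^ 2) =
      √(Real.pi / b) * (Nat.doubleFactorial (2 * k - 1) / (2 * b) ^ k) := by
  have h1 : ∀ x : ℝ, x ^ (2 * k) * Real.exp (-b * x ^ 2) =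
      (fun y : ℝ => y ^ (2 * k) * Real.exp (-b * y ^ 2)) |x| := by
    intro x
    show _ = |x| ^ (2 * k) * Real.exp (-b * |x| ^ 2)
    rw [pow_mul, pow_mul, sq_abs]
  rw [funext h1, integral_comp_abs (f := fun y : ℝ => y ^ (2 * k) * Real.exp (-b * y ^ 2))]
  have h2 := integral_rpow_mul_exp_neg_mul_rpow (p := 2) (q := ((2 * k : ℕ) : ℝ)) (b := b)
    (by norm_num) (by linarith [((2 * k : ℕ).cast_nonneg (α := ℝ))]) hb
  have h3 : ∫ x in Set.Ioi (0 : ℝ), x ^ (2 * k) * Real.exp (-b * x ^ 2) =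
      ∫ x in Set.Ioi (0 : ℝ), x ^ ((2 * k : ℕ) : ℝ) * Real.exp (-b * x ^ (2 : ℝ)) := by
    refine setIntegral_congr_fun measurableSet_Ioi fun x _ => ?_
    simp only [Real.rpow_natCast, Real.rpow_two]
  rw [h3, h2]
  have h4 : (((2 * k : ℕ) : ℝ) + 1) / 2 = k + 1 / 2 := by push_cast; ring
  rw [neg_div, h4, Real.Gamma_nat_add_half, Real.rpow_neg hb.le, Real.rpow_add hb,
    Real.rpow_natCast, ← Real.sqrt_eq_rpow, Real.sqrt_div Real.pi_pos.le, mul_pow]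
  have := Real.sqrt_pos.2 hb
  field_simp

theorem integrable_and_integral_mono_mul_exp (b c : ℝ) (hb : 0 < b) (hc : 0 < c) (i j : ℕ) :
    Integrable (fun k : Fin 2 → ℝ =>
      (k 0 ^ i * k 1 ^ j) * Real.exp (-b * k 0 ^ 2 + -c * k 1 ^ 2)) ∧
    ∫ k : Fin 2 → ℝ, (k 0 ^ i * k 1 ^ j) * Real.exp (-b * k 0 ^ 2 + -c * k 1 ^ 2) =
      (∫ x : ℝ, x ^ i * Real.exp (-b * x ^ 2)) * ∫ x : ℝ, x ^ j * Real.exp (-c * x ^ 2) := by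
  let f : Fin 2 → ℝ → ℝ :=
    ![fun x => x ^ i * Real.exp (-b * x ^ 2), fun x => x ^ j * Real.exp (-c * x ^ 2)]
  have hf : (fun k : Fin 2 → ℝ =>
      (k 0 ^ i * k 1 ^ j) * Real.exp (-b * k 0 ^ 2 + -c * k 1 ^ 2)) = fun k => ∏ l, f l (k l) := by
    funext k
    simp only [Fin.prod_univ_two, f, Matrix.cons_val_zero, Matrix.cons_val_one, Real.exp_add]
    ring
  rw [hf]
  constructor
  · refine Integrable.fintype_prod (f := f) fun l => ?_
    fin_cases l
    · exact integrable_pow_mul_exp_neg_mul_sq hb i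
    · exact integrable_pow_mul_exp_neg_mul_sq hc j
  · rw [integral_fintype_prod_volume_eq_prod, Fin.prod_univ_two]
    rfl

theorem covLimit_form (k : Fin 2 → ℝ) :
    -(k ⬝ᵥ covLimit.mulVec k) / 2 = -(k 0 ^ 2 + k 0 * k 1 + k 1 ^ 2 / 3) / 2 := by
  simp [covLimit, Matrix.mulVec, dotProduct, Fin.sum_univ_two]
  ring

/-- Monomials are integrable against the Gaussian weight, by comparison with an isotropic one. -/
theorem integrable_mono_mul_gaussian (i j : ℕ) :
    Integrable (fun k : Fin 2 → ℝ =>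
      (k 0 ^ i * k 1 ^ j) * Real.exp (-(k ⬝ᵥ covLimit.mulVec k) / 2)) := by
  simp_rw [covLimit_form]
  have h := (integrable_and_integral_mono_mul_exp (1 / 40) (1 / 40) (by norm_num) (by norm_num) i j).1
  refine h.mono (by fun_prop) (Eventually.of_forall fun k => ?_)
  rw [norm_mul, norm_mul (k 0 ^ i * k 1 ^ j)]
  refine mul_le_mul_of_nonneg_left ?_ (norm_nonneg _)
  rw [Real.norm_of_nonneg (Real.exp_pos _).le, Real.norm_of_nonneg (Real.exp_pos _).le,
    Real.exp_le_exp]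
  nlinarith [sq_nonneg (k 0 * 19 / 20 + k 1 / 2 ), sq_nonneg (k 0), sq_nonneg (k 1)]

theorem prod_comp_fin_two {r : ℕ} (a : Fin r → Fin 2) :
    ∃ i j : ℕ, ∀ k : Fin 2 → ℝ, ∏ l, k (a l) = k 0 ^ i * k 1 ^ j := by
  refine ⟨(Finset.univ.filter fun l => a l = 0).card, (Finset.univ.filter fun l => a l = 1).card,
    fun k => ?_⟩
  rw [← Finset.prod_fiberwise (s := Finset.univ) (g := a) , Fin.prod_univ_two]
  congr 1 <;> rw [← Finset.prod_const] <;> refine Finset.prod_congr rfl fun l hl => ?_ <;>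
    rw [(Finset.mem_filter.1 hl).2]

/-- The shear `(z, w) ↦ (z - w / 2, w)`, which diagonalises the form `covLimit`. -/
def shear : Matrix.TransvectionStruct (Fin 2) ℝ := ⟨0, 1, by decide, -1 / 2⟩

theorem shear_apply (k : Fin 2 → ℝ) :
    Matrix.toLin' shear.toMatrix k = ![k 0 - k 1 / 2, k 1] := by
  ext i
  fin_cases i
  · simp [shear, Matrix.TransvectionStruct.toMatrix, Matrix.transvection, Matrix.single]
    ring
  · simp [shear, Matrix.TransvectionStruct.toMatrix, Matrix.transvection, Matrix.single]

/-- The change of variables by the shear, which preserves the measure. -/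
theorem integral_mul_gaussian_eq (f : (Fin 2 → ℝ) → ℝ) (hf : Continuous f) :
    ∫ k : Fin 2 → ℝ, f k * Real.exp (-(k ⬝ᵥ covLimit.mulVec k) / 2) =
      ∫ k : Fin 2 → ℝ, f ![k 0 - k 1 / 2, k 1] *
        Real.exp (-(1 / 2) * k 0 ^ 2 + -(1 / 24) * k 1 ^ 2) := by
  have hT := Real.volume_preserving_transvectionStruct shear
  simp_rw [covLimit_form]
  rw [← hT.map_eq, integral_map hT.measurable.aemeasurable
    (by rw [hT.map_eq]; exact Continuous.aestronglyMeasurable (by fun_prop)), hT.map_eq]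
  congr 1
  funext k
  rw [shear_apply]
  simp only [Matrix.cons_val_zero, Matrix.cons_val_one]
  congr 2
  ring

theorem sum_fin_succ_arrow {n : ℕ} (F : (Fin (n + 1) → Fin 2) → ℝ) :
    ∑ a, F a = ∑ a : Fin n → Fin 2, (F (Fin.cons 0 a) + F (Fin.cons 1 a)) := by
  rw [← (Fin.consEquiv fun _ : Fin (n + 1) => Fin 2).sum_comp, Fintype.sum_prod_type_right]
  simp [Fin.sum_univ_two, Fin.consEquiv]

theorem vertex_eq {r : ℕ} (a : Fin r → Fin 2) :
    vertex a = 1 / (1 + ∑ i, if a i = 1 then (1 : ℝ) else 0) := by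
  rw [vertex, Finset.card_filter]
  push_cast
  rfl

/-- The contraction of three vertex indices; it equals `∫ (k 0 + k 1 y) ^ 3` over `0 ≤ y ≤ 1`. -/
theorem sum_vertex_three (k : Fin 2 → ℝ) :
    ∑ a : Fin 3 → Fin 2, vertex a * ∏ i, k (a i) =
      k 0 ^ 3 + 3 / 2 * k 0 ^ 2 * k 1 + k 0 * k 1 ^ 2 + k 1 ^ 3 / 4 := by
  simp only [vertex_eq, sum_fin_succ_arrow, Fintype.sum_unique, Fin.sum_univ_succ,
    Fin.prod_univ_succ, Fin.cons_zero, Fin.cons_succ, Finset.univ_eq_empty,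
    Finset.prod_empty]
  norm_num
  ring

/-- The contraction of four vertex indices; it equals `∫ (k 0 + k 1 y) ^ 4` over `0 ≤ y ≤ 1`. -/
theorem sum_vertex_four (k : Fin 2 → ℝ) :
    ∑ a : Fin 4 → Fin 2, vertex a * ∏ i, k (a i) =
      k 0 ^ 4 + 2 * k 0 ^ 3 * k 1 + 2 * k 0 ^ 2 * k 1 ^ 2 + k 0 * k 1 ^ 3 + k 1 ^ 4 / 5 := by
  simp only [vertex_eq, sum_fin_succ_arrow, Fintype.sum_unique, Fin.sum_univ_succ,
    Fin.prod_univ_succ, Fin.cons_zero, Fin.cons_succ, Finset.univ_eq_empty,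
    Finset.prod_empty]
  norm_num
  ring

theorem integral_mono_diag (i j : ℕ) :
    ∫ k : Fin 2 → ℝ, (k 0 ^ (2 * i) * k 1 ^ (2 * j)) *
        Real.exp (-(1 / 2) * k 0 ^ 2 + -(1 / 24) * k 1 ^ 2) =
      √(Real.pi / (1 / 2)) * √(Real.pi / (1 / 24)) *
        (Nat.doubleFactorial (2 * i - 1) * Nat.doubleFactorial (2 * j - 1) * 12 ^ j) := by
  rw [(integrable_and_integral_mono_mul_exp (1 / 2) (1 / 24) (by norm_num) (by norm_num) _ _).2,
    integral_pow_two_mul_mul_exp_neg_mul_sq (by norm_num),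
    integral_pow_two_mul_mul_exp_neg_mul_sq (by norm_num),
    show (2 * (1 / 2) : ℝ) = 1 by norm_num, show (2 * (1 / 24) : ℝ) = (12 : ℝ)⁻¹ by norm_num]
  rw [inv_pow, one_pow]
  field_simp

/-- The Gaussian mean of a polynomial that the shear turns into a combination of three monomials with
even exponents. In the new coordinates the variances are `1` and `12`. -/
theorem gaussianMean_eq {f : (Fin 2 → ℝ) → ℝ} (hf : Continuous f) (c0 c1 c2 : ℝ) (i0 i1 i2 j0 j1 j2 : ℕ)
    (h : ∀ z w : ℝ, f ![z - w / 2, w] = c0 * (z ^ (2 * i0) * w ^ (2 * j0)) +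
      c1 * (z ^ (2 * i1) * w ^ (2 * j1)) + c2 * (z ^ (2 * i2) * w ^ (2 * j2))) :
    gaussianMean f =
      c0 * (Nat.doubleFactorial (2 * i0 - 1) * Nat.doubleFactorial (2 * j0 - 1) * 12 ^ j0) +
      c1 * (Nat.doubleFactorial (2 * i1 - 1) * Nat.doubleFactorial (2 * j1 - 1) * 12 ^ j1) +
      c2 * (Nat.doubleFactorial (2 * i2 - 1) * Nat.doubleFactorial (2 * j2 - 1) * 12 ^ j2) := by
  have hint := fun i j : ℕ =>
    (integrable_and_integral_mono_mul_exp (1 / 2) (1 / 24) (by norm_num) (by norm_num) (2 * i) (2 * j)).1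
  have hZ : ∫ k : Fin 2 → ℝ, Real.exp (-(k ⬝ᵥ covLimit.mulVec k) / 2) =
      √(Real.pi / (1 / 2)) * √(Real.pi / (1 / 24)) := by
    have h1 := integral_mul_gaussian_eq (fun _ => 1) continuous_const
    have h2 := integral_mono_diag 0 0
    simp only [mul_zero, pow_zero, one_mul] at h1 h2
    rw [h1, h2]
    simp [Nat.doubleFactorial]
  have hpos : 0 < √(Real.pi / (1 / 2)) * √(Real.pi / (1 / 24)) := by
    have := Real.pi_pos
    positivity
  rw [gaussianMean, hZ, integral_mul_gaussian_eq f hf, div_eq_iff hpos.ne']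
  simp_rw [h, add_mul, mul_assoc _ (_ * _) (Real.exp _)]
  rw [integral_add, integral_add, integral_const_mul, integral_const_mul, integral_const_mul,
    integral_mono_diag, integral_mono_diag, integral_mono_diag]
  · ring
  · exact (hint _ _).const_mul _
  · exact (hint _ _).const_mul _
  · exact ((hint _ _).const_mul _).add ((hint _ _).const_mul _)
  · exact (hint _ _).const_mul _

/-- Linearity of `gaussianMean` on monomials. -/
theorem gaussianMean_sum {ι : Type*} (s : Finset ι) (c : ι → ℝ) (f : ι → (Fin 2 → ℝ) → ℝ)
    (hf : ∀ a ∈ s, ∃ i j : ℕ, ∀ k, f a k = k 0 ^ i * k 1 ^ j) :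
    ∑ a ∈ s, c a * gaussianMean (f a) = gaussianMean fun k => ∑ a ∈ s, c a * f a k := by
  simp only [gaussianMean, Finset.sum_mul]
  rw [integral_finsetSum, Finset.sum_div]
  · refine Finset.sum_congr rfl fun a _ => ?_
    simp_rw [mul_assoc]
    rw [integral_const_mul, mul_div_assoc]
  · intro a ha
    obtain ⟨i, j, h⟩ := hf a ha
    simp_rw [h, mul_assoc]
    simpa only [mul_assoc] using (integrable_mono_mul_gaussian i j).const_mul (c a)

/-- After the shear the two contracted vertices are `z ^ 3 + z w ^ 2 / 4` and
`z ^ 4 + z ^ 2 w ^ 2 / 2 + w ^ 4 / 80`, so that `K₁ = -60 / 72 + (72 / 5) / 24`. -/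
theorem K₁_eq : K₁ = -7 / 30 := by
  have h6 : ∑ a : Fin 3 → Fin 2, ∑ b : Fin 3 → Fin 2,
      vertex a * vertex b / 72 * gaussianMean (fun k => (∏ i, k (a i)) * ∏ i, k (b i)) = 5 / 6 := by
    rw [← Finset.sum_product']
    rw [gaussianMean_sum (f := fun p : (Fin 3 → Fin 2) × (Fin 3 → Fin 2) => fun k =>
      (∏ i, k (p.1 i)) * ∏ i, k (p.2 i))]
    · have hs : (fun k : Fin 2 → ℝ => ∑ p ∈ (Finset.univ : Finset (Fin 3 → Fin 2)) ×ˢ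
          (Finset.univ : Finset (Fin 3 → Fin 2)),
          vertex p.1 * vertex p.2 / 72 * ((∏ i, k (p.1 i)) * ∏ i, k (p.2 i))) =
          fun k => (k 0 ^ 3 + 3 / 2 * k 0 ^ 2 * k 1 + k 0 * k 1 ^ 2 + k 1 ^ 3 / 4) ^ 2 / 72 := by
        funext k
        rw [← sum_vertex_three, sq, Finset.sum_mul_sum, Finset.sum_div, Finset.sum_product]
        refine Finset.sum_congr rfl fun a _ => ?_
        rw [Finset.sum_div]
        refine Finset.sum_congr rfl fun b _ => ?_
        ring
      rw [hs, gaussianMean_eq (by fun_prop) (1 / 72) (1 / 144) (1 / 1152) 3 2 1 0 1 2]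
      · norm_num [Nat.doubleFactorial]
      · intro z w
        simp only [Matrix.cons_val_zero, Matrix.cons_val_one]
        ring
    · intro p _
      obtain ⟨i, j, h1⟩ := prod_comp_fin_two p.1
      obtain ⟨i', j', h2⟩ := prod_comp_fin_two p.2
      exact ⟨i + i', j + j', fun k => by rw [h1, h2]; ring⟩
  have h4 : ∑ a : Fin 4 → Fin 2, vertex a / 24 * gaussianMean (fun k => ∏ i, k (a i)) =
      3 / 5 := by
    rw [gaussianMean_sum (f := fun a : (Fin 4 → Fin 2) => fun k => ∏ i, k (a i))]
    · have hs : (fun k : Fin 2 → ℝ => ∑ a : Fin 4 → Fin 2, vertex a / 24 * ∏ i, k (a i)) =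
          fun k => (k 0 ^ 4 + 2 * k 0 ^ 3 * k 1 + 2 * k 0 ^ 2 * k 1 ^ 2 + k 0 * k 1 ^ 3 +
            k 1 ^ 4 / 5) / 24 := by
        funext k
        rw [← sum_vertex_four, Finset.sum_div]
        refine Finset.sum_congr rfl fun a _ => ?_
        ring
      rw [hs, gaussianMean_eq (by fun_prop) (1 / 24) (1 / 48) (1 / 1920) 2 1 0 0 1 2]
      · norm_num [Nat.doubleFactorial]
      · intro z w
        simp only [Matrix.cons_val_zero, Matrix.cons_val_one]
        ring
    · exact fun a _ => prod_comp_fin_two a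
  rw [K₁, h6, h4]
  norm_num

open Real

/-! ### The cardinal sine beyond its Gaussian part -/

theorem le_sinc_of_abs_le_two {x : ℝ} (hx : |x| ≤ 2) : 3 / 10 ≤ sinc x := by
  wlog h0 : 0 ≤ x generalizing x
  · rw [← sinc_neg]
    exact this (by rwa [abs_neg]) (by linarith)
  rw [abs_of_nonneg h0] at hx
  rcases h0.eq_or_lt with rfl | hpos
  · rw [sinc_zero]; norm_num
  rw [sinc_of_ne_zero hpos.ne', le_div_iff₀ hpos]
  have h1 : sin x = 2 * sin (x / 2) * cos (x / 2) := by
    rw [← sin_two_mul]; congr 1; ring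
  have h2 : 2 / π * (x / 2) ≤ sin (x / 2) :=
    mul_le_sin (by linarith) (by linarith [Real.pi_gt_three])
  have h3 : 1 - (x / 2) ^ 2 / 2 ≤ cos (x / 2) := one_sub_sq_div_two_le_cos
  have h4 : 3 / 5 ≤ 2 / π := by
    rw [div_le_div_iff₀ (by norm_num) pi_pos]; linarith [pi_lt_d2]
  have h5 : 3 / 5 * (x / 2) ≤ sin (x / 2) := le_trans (by gcongr) h2
  have h6 : 1 / 2 ≤ cos (x / 2) := by nlinarith
  rw [h1]
  nlinarith

/-- The Gaussian-corrected cardinal sine `sinc x * exp (x ^ 2 / 6)`. -/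
def sincExp (x : ℝ) : ℝ := sinc x * exp (x ^ 2 / 6)

theorem sincExp_neg (x : ℝ) : sincExp (-x) = sincExp x := by
  rw [sincExp, sincExp, sinc_neg, neg_sq]

theorem sincExp_zero : sincExp 0 = 1 := by simp [sincExp]

theorem sincExp_pos {x : ℝ} (hx : |x| ≤ 2) : 0 < sincExp x :=
  mul_pos (by linarith [le_sinc_of_abs_le_two hx]) (exp_pos _)

theorem one_sub_mul_exp_le {s t : ℝ} (hs : 0 ≤ s) (hst : s ≤ t) :
    (1 - t) * exp t ≤ (1 - s) * exp s := by
  have h1 : 1 - (t - s) ≤ exp (-(t - s)) := one_sub_le_exp_neg _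
  by_cases h2 : s ≤ 1
  · have h3 : 1 - t ≤ (1 - s) * exp (-(t - s)) := by
      nlinarith [mul_nonneg hs (sub_nonneg.2 hst), mul_le_mul_of_nonneg_left h1 (sub_nonneg.2 h2)]
    calc (1 - t) * exp t ≤ (1 - s) * exp (-(t - s)) * exp t := by gcongr
      _ = (1 - s) * exp s := by rw [mul_assoc, ← exp_add]; ring_nf
  · push Not at h2
    have h3 : exp s ≤ exp t := exp_le_exp.2 hst
    nlinarith [exp_pos s, mul_le_mul_of_nonneg_left h3 (by linarith : (0 : ℝ) ≤ t - 1)]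

/-- The Euler product of the sine, with the Gaussian factor distributed by `∑ 1 / j ^ 2 = π ^ 2 / 6`. -/
theorem tendsto_prod_sincExp (y : ℝ) :
    Tendsto (fun n : ℕ => ∏ j ∈ Finset.range n,
      ((1 - y ^ 2 / ((j : ℝ) + 1) ^ 2) * exp (y ^ 2 / ((j : ℝ) + 1) ^ 2)))
      atTop (𝓝 (sincExp (π * y))) := by
  rcases eq_or_ne y 0 with rfl | hy
  · simp [sincExp_zero]
  have h1 : Tendsto (fun n : ℕ => ∏ j ∈ Finset.range n, (1 - y ^ 2 / ((j : ℝ) + 1) ^ 2))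
      atTop (𝓝 (sinc (π * y))) := by
    have hpy : π * y ≠ 0 := mul_ne_zero pi_ne_zero hy
    rw [sinc_of_ne_zero hpy]
    refine ((tendsto_euler_sin_prod y).div_const (π * y)).congr fun n => ?_
    field_simp
  have h2 : Tendsto (fun n : ℕ => ∑ j ∈ Finset.range n, y ^ 2 / ((j : ℝ) + 1) ^ 2)
      atTop (𝓝 ((π * y) ^ 2 / 6)) := by
    have h3 := ((hasSum_nat_add_iff' 1).2 hasSum_zeta_two).mul_left (y ^ 2)
    have h4 := h3.tendsto_sum_nat
    convert h4 using 2
    · refine Finset.sum_congr rfl fun j _ => ?_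
      push_cast; ring
    · simp; ring
  have h5 := h1.mul ((continuous_exp.tendsto _).comp h2)
  refine h5.congr fun n => ?_
  simp only [Function.comp]
  rw [exp_sum, ← Finset.prod_mul_distrib]

/-- Each factor `(1 - s) * exp s` of the Euler product is decreasing in `s ≥ 0`. -/
theorem antitoneOn_sincExp : AntitoneOn sincExp (Set.Icc 0 π) := by
  intro a ha b hb hab
  have key : ∀ x y : ℝ, 0 ≤ x → x ≤ y → y ≤ 1 → sincExp (π * y) ≤ sincExp (π * x) := by
    intro x y hx hxy hy
    refine le_of_tendsto_of_tendsto' (tendsto_prod_sincExp y) (tendsto_prod_sincExp x) fun n => ?_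
    refine Finset.prod_le_prod (fun j _ => mul_nonneg ?_ (exp_pos _).le) fun j _ => ?_
    · have : y ^ 2 / ((j : ℝ) + 1) ^ 2 ≤ 1 := by
        rw [div_le_one (by positivity)]
        have : (0 : ℝ) ≤ j := j.cast_nonneg
        nlinarith
      linarith
    · exact one_sub_mul_exp_le (by positivity) (by gcongr)
  have h := key (a / π) (b / π) (by have := ha.1; positivity) (by gcongr)
    (by rw [div_le_one pi_pos]; exact hb.2)
  rwa [mul_div_cancel₀ _ pi_ne_zero, mul_div_cancel₀ _ pi_ne_zero] at h

theorem abs_sin_sub_taylor_le {x : ℝ} (hx : |x| ≤ 2) :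
    |sin x - (x - x ^ 3 / 6 + x ^ 5 / 120 - x ^ 7 / 5040)| ≤ |x| ^ 9 := by
  have h := Complex.exp_bound' (x := x * Complex.I) (n := 9) (by
    rw [norm_mul, Complex.norm_I, mul_one, Complex.norm_real, Real.norm_eq_abs]
    norm_num
    linarith)
  have h2 := (Complex.abs_im_le_norm _).trans h
  rw [norm_mul, Complex.norm_I, mul_one, Complex.norm_real, Real.norm_eq_abs] at h2
  have h3 : (Complex.exp (x * Complex.I) -
      ∑ m ∈ Finset.range 9, (x * Complex.I) ^ m / (m.factorial : ℂ)).im =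
      sin x - (x - x ^ 3 / 6 + x ^ 5 / 120 - x ^ 7 / 5040) := by
    have hs : ∑ m ∈ Finset.range 9, (x * Complex.I) ^ m / (m.factorial : ℂ) =
        ((1 - x ^ 2 / 2 + x ^ 4 / 24 - x ^ 6 / 720 + x ^ 8 / 40320 : ℝ) : ℂ) +
        ((x - x ^ 3 / 6 + x ^ 5 / 120 - x ^ 7 / 5040 : ℝ) : ℂ) * Complex.I := by
      have I2 : Complex.I ^ 2 = -1 := Complex.I_sq
      have I3 : Complex.I ^ 3 = -Complex.I := by rw [pow_succ, I2]; ring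
      have I4 : Complex.I ^ 4 = 1 := Complex.I_pow_four
      have I5 : Complex.I ^ 5 = Complex.I := by rw [pow_succ, I4]; ring
      have I6 : Complex.I ^ 6 = -1 := by rw [pow_succ, I5, ← sq, I2]
      have I7 : Complex.I ^ 7 = -Complex.I := by rw [pow_succ, I6]; ring
      have I8 : Complex.I ^ 8 = 1 := by rw [pow_succ, I7, neg_mul, ← sq, I2]; ring
      simp only [Finset.sum_range_succ, Finset.sum_range_zero, mul_pow, I2, I3, I4, I5, I6, I7, I8,
        Nat.factorial]
      push_cast
      ring
    rw [hs, Complex.exp_mul_I, Complex.sub_im, Complex.add_im, Complex.add_im,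
      Complex.mul_I_im, Complex.mul_I_im, ← Complex.ofReal_cos, ← Complex.ofReal_sin]
    simp only [Complex.ofReal_im, Complex.ofReal_re, zero_add]
  rw [h3] at h2
  refine h2.trans ?_
  have : (0 : ℝ) ≤ |x| ^ 9 := by positivity
  norm_num [Nat.factorial]
  linarith

theorem abs_sinc_sub_taylor_le {x : ℝ} (hx : |x| ≤ 2) :
    |sinc x - (1 - x ^ 2 / 6 + x ^ 4 / 120 - x ^ 6 / 5040)| ≤ x ^ 8 := by
  rcases eq_or_ne x 0 with rfl | h0
  · simp
  have h := abs_sin_sub_taylor_le hx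
  have h1 : sin x - (x - x ^ 3 / 6 + x ^ 5 / 120 - x ^ 7 / 5040) =
      x * (sinc x - (1 - x ^ 2 / 6 + x ^ 4 / 120 - x ^ 6 / 5040)) := by
    rw [sinc_of_ne_zero h0]; field_simp
  rw [h1, abs_mul, pow_succ' |x| 8, (by decide : Even 8).pow_abs] at h
  exact le_of_mul_le_mul_left h (abs_pos.2 h0)

/-- Minus the logarithm of `sincExp`: the part of `-log sinc` beyond the quadratic term. -/
def sincRem (x : ℝ) : ℝ := -log (sincExp x)

theorem exp_neg_sincRem {x : ℝ} (hx : |x| ≤ 2) : exp (-sincRem x) = sincExp x := by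
  rw [sincRem, neg_neg, exp_log (sincExp_pos hx)]

theorem sincRem_abs (x : ℝ) : sincRem |x| = sincRem x := by
  rcases abs_choice x with h | h <;> rw [h]
  rw [sincRem, sincExp_neg, sincRem]

theorem sincRem_mono {x y : ℝ} (h : |x| ≤ |y|) (hy : |y| ≤ 2) : sincRem x ≤ sincRem y := by
  rw [← sincRem_abs x, ← sincRem_abs y, sincRem, sincRem, neg_le_neg_iff]
  have hpi := pi_gt_three
  exact log_le_log (sincExp_pos (by rwa [abs_abs]))
    (antitoneOn_sincExp ⟨abs_nonneg _, by linarith⟩ ⟨abs_nonneg _, by linarith⟩ h)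

theorem sincRem_nonneg {x : ℝ} (hx : |x| ≤ 2) : 0 ≤ sincRem x := by
  have := sincRem_mono (x := 0) (y := x) (by simp) hx
  rwa [sincRem, sincExp_zero, log_one, neg_zero] at this

/-- The expansion `-log sinc x = x ^ 2 / 6 + x ^ 4 / 180 + x ^ 6 / 2835 + O(x ^ 8)` on `[-2, 2]`. -/
theorem abs_sincRem_sub_le : ∃ C : ℝ, 0 ≤ C ∧ ∀ x : ℝ, |x| ≤ 2 →
    |sincRem x - (x ^ 4 / 180 + x ^ 6 / 2835)| ≤ C * x ^ 8 := by
  -- the crude bound `1 - sinc x ≤ 65 x ^ 2` for the logarithm's remainder makes the constant large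
  refine ⟨10 ^ 8, by norm_num, fun x hx => ?_⟩
  obtain ⟨w, hw⟩ : ∃ w, w = x ^ 2 := ⟨_, rfl⟩
  have hw0 : 0 ≤ w := hw ▸ sq_nonneg x
  have hw4 : w ≤ 4 := by
    rw [hw, ← sq_abs]; nlinarith [abs_nonneg x]
  have e4 : x ^ 4 = w ^ 2 := by rw [hw]; ring
  have e6 : x ^ 6 = w ^ 3 := by rw [hw]; ring
  have e8 : x ^ 8 = w ^ 4 := by rw [hw]; ring
  have hT := abs_sinc_sub_taylor_le hx
  have hpos := le_sinc_of_abs_le_two hx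
  have hle := sinc_le_one x
  rw [← hw, e4, e6, e8] at hT
  obtain ⟨y, hy⟩ : ∃ y, y = 1 - sinc x := ⟨_, rfl⟩
  have hy0 : 0 ≤ y := by linarith
  have hy1 : y ≤ 7 / 10 := by linarith
  obtain ⟨e, he⟩ : ∃ e, e = y - (w / 6 - w ^ 2 / 120 + w ^ 3 / 5040) := ⟨_, rfl⟩
  have heb : |e| ≤ w ^ 4 := by
    rw [abs_sub_comm] at hT
    convert hT using 2
    rw [he, hy]; ring
  have hlog := abs_log_sub_add_sum_range_le (x := y) (by rw [abs_of_nonneg hy0]; linarith) 3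
  rw [abs_of_nonneg hy0] at hlog
  simp only [Finset.sum_range_succ, Finset.sum_range_zero] at hlog
  norm_num at hlog
  have h1y : 1 - y = sinc x := by rw [hy]; ring
  have hlogq : sincRem x = -log (1 - y) - w / 6 := by
    rw [sincRem, sincExp, log_mul (by linarith) (exp_pos _).ne', log_exp, h1y, hw]; ring
  obtain ⟨p, hp⟩ : ∃ p, p = 1 / 6 - w / 120 + w ^ 2 / 5040 := ⟨_, rfl⟩
  have hw2 : w ^ 2 ≤ 16 := (pow_le_pow_left₀ hw0 hw4 2).trans_eq (by norm_num)
  have hw2' : 0 ≤ w ^ 2 := sq_nonneg w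
  have hp0 : 0 ≤ p := by rw [hp]; linarith
  have hp1 : p ≤ 1 / 6 := by rw [hp]; nlinarith only [hw0, hw4]
  have hye : y = w * p + e := by rw [he, hp]; ring
  have hw43 : w ^ 4 ≤ 64 * w := by
    have h3 : w ^ 3 ≤ 64 := (pow_le_pow_left₀ hw0 hw4 3).trans_eq (by norm_num)
    calc w ^ 4 = w ^ 3 * w := by ring
      _ ≤ 64 * w := by gcongr
  have hyw : y ≤ 65 * w := by
    have h9 := le_abs_self e
    have h10 : w * p ≤ w * (1 / 6) := by gcongr
    linarith
  have hE : |sincRem x - (y + y ^ 2 / 2 + y ^ 3 / 3 - w / 6)| ≤ 65 ^ 4 * w ^ 4 * 4 := by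
    rw [hlogq, show -log (1 - y) - w / 6 - (y + y ^ 2 / 2 + y ^ 3 / 3 - w / 6) =
      -(y + y ^ 2 / 2 + y ^ 3 / 3 + log (1 - y)) by ring, abs_neg]
    refine hlog.trans ?_
    rw [div_le_iff₀ (by linarith)]
    have h2 : y ^ 4 ≤ (65 * w) ^ 4 := by gcongr
    have h3 : (0 : ℝ) ≤ w ^ 4 := by positivity
    rw [mul_pow] at h2
    nlinarith only [h2, h3, hy1]
  obtain ⟨a, ha⟩ : ∃ a, a = 1 / 14400 + 1 / 15120 - w / 302400 + w ^ 2 / 25401600 := ⟨_, rfl⟩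
  obtain ⟨b, hb⟩ : ∃ b, b = (-1 / 120 + w / 5040) * (p ^ 2 + p / 6 + 1 / 36) := ⟨_, rfl⟩
  have ha1 : |a| ≤ 1 := by
    rw [abs_le, ha]; constructor <;> linarith
  have hb1 : |b| ≤ 1 := by
    rw [hb, abs_mul]
    refine mul_le_one₀ ?_ (abs_nonneg _) ?_
    · rw [abs_le]; constructor <;> linarith
    · have hp2 : p ^ 2 ≤ 1 / 36 := (pow_le_pow_left₀ hp0 hp1 2).trans_eq (by norm_num)
      rw [abs_of_nonneg (by positivity)]
      linarith
  have hmain : y + y ^ 2 / 2 + y ^ 3 / 3 - w / 6 - (w ^ 2 / 180 + w ^ 3 / 2835) =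
      e * (1 + (y + w * p) / 2 + (y ^ 2 + y * (w * p) + (w * p) ^ 2) / 3) +
        w ^ 4 * (a / 2 + b / 3) := by
    rw [hb, ha, hye, hp]; ring
  have hwp : w * p ≤ 1 := (mul_le_mul hw4 hp1 hp0 (by norm_num)).trans (by norm_num)
  have hwp0 : 0 ≤ w * p := by positivity
  have hbr : |1 + (y + w * p) / 2 + (y ^ 2 + y * (w * p) + (w * p) ^ 2) / 3| ≤ 4 := by
    have hyy : y ^ 2 ≤ 1 := pow_le_one₀ hy0 (by linarith)
    have hpp : (w * p) ^ 2 ≤ 1 := pow_le_one₀ hwp0 hwp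
    have hyp : y * (w * p) ≤ 1 := mul_le_one₀ (by linarith) hwp0 hwp
    rw [abs_of_nonneg (by positivity)]
    linarith
  have hmain2 : |y + y ^ 2 / 2 + y ^ 3 / 3 - w / 6 - (w ^ 2 / 180 + w ^ 3 / 2835)| ≤ 5 * w ^ 4 := by
    rw [hmain]
    refine (abs_add_le _ _).trans ?_
    rw [abs_mul, abs_mul, abs_of_nonneg (by positivity : (0 : ℝ) ≤ w ^ 4)]
    have h5 : |a / 2 + b / 3| ≤ 1 := by
      rw [abs_le] at *; constructor <;> linarith [ha1.1, ha1.2, hb1.1, hb1.2]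
    have h6 := mul_le_mul heb hbr (abs_nonneg _) (by positivity)
    have h7 : w ^ 4 * |a / 2 + b / 3| ≤ w ^ 4 * 1 := by gcongr
    linarith
  rw [e4, e6, e8]
  have h8 := abs_sub_le (sincRem x) (y + y ^ 2 / 2 + y ^ 3 / 3 - w / 6)
    (w ^ 2 / 180 + w ^ 3 / 2835)
  have : (0 : ℝ) ≤ w ^ 4 := by positivity
  norm_num at hE ⊢
  linarith

/-! ### The generating function near the origin -/

/-- The exponent beyond the Gaussian term of `centeredGen m A` at `u / m`. -/
def centralRem (m A : ℕ) (u : ℝ) : ℝ :=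
  ∑ i ∈ Finset.range A, (sincRem ((m - i) * (u / m)) - sincRem ((i + 1) * (u / m)))

theorem sin_eq_mul_exp {x : ℝ} (hx : |x| ≤ 2) :
    sin x = x * (exp (-(x ^ 2 / 6)) * exp (-sincRem x)) := by
  rcases eq_or_ne x 0 with rfl | h0
  · simp
  have h : sincExp x * exp (-(x ^ 2 / 6)) = sin x / x := by
    rw [sincExp, mul_assoc, ← exp_add, sinc_of_ne_zero h0]
    simp
  rw [exp_neg_sincRem hx, mul_comm (exp _), h]
  field_simp

theorem sum_sq_sub_sq (m A : ℕ) :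
    ∑ i ∈ Finset.range A, (((m : ℝ) - i) ^ 2 - ((i : ℝ) + 1) ^ 2) =
      (A : ℝ) * (m - A) * (m + 1) := by
  induction A with
  | zero => simp
  | succ A ih => rw [Finset.sum_range_succ, ih]; push_cast; ring

theorem prod_sub_div_eq_choose {m A : ℕ} (h : A ≤ m) :
    ∏ i ∈ Finset.range A, (((m : ℝ) - i) / (i + 1)) = m.choose A := by
  rw [Finset.prod_div_distrib]
  have h1 : ∏ i ∈ Finset.range A, ((i : ℝ) + 1) = A.factorial := by
    rw [← Finset.prod_range_add_one_eq_factorial]; push_cast; rfl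
  have h2 : ∏ i ∈ Finset.range A, ((m : ℝ) - i) = m.descFactorial A := by
    rw [Nat.descFactorial_eq_prod_range, Nat.cast_prod]
    refine Finset.prod_congr rfl fun i hi => ?_
    rw [Nat.cast_sub (by have := Finset.mem_range.1 hi; omega)]
  rw [h1, h2, Nat.descFactorial_eq_factorial_mul_choose]
  have : (A.factorial : ℝ) ≠ 0 := by exact_mod_cast A.factorial_ne_zero
  push_cast
  field_simp

section
variable {m A i : ℕ} {u : ℝ}

theorem abs_upper_arg (hm : 0 < m) (hA : 2 * A ≤ m) (hi : i < A) (u : ℝ) :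
    |((m : ℝ) - i) * (u / m)| = (1 - i / m) * |u| := by
  have hm' : (0 : ℝ) < m := by exact_mod_cast hm
  have : (i : ℝ) ≤ m := by exact_mod_cast (by omega : i ≤ m)
  rw [abs_mul, abs_of_nonneg (by linarith), abs_div, abs_of_pos hm']
  field_simp

theorem abs_lower_arg (hm : 0 < m) (u : ℝ) :
    |((i : ℝ) + 1) * (u / m)| = (i + 1) / m * |u| := by
  have hm' : (0 : ℝ) < m := by exact_mod_cast hm
  rw [abs_mul, abs_of_nonneg (by positivity), abs_div, abs_of_pos hm']
  field_simp

theorem abs_upper_arg_le (hm : 0 < m) (hA : 2 * A ≤ m) (hi : i < A) :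
    |((m : ℝ) - i) * (u / m)| ≤ |u| := by
  rw [abs_upper_arg hm hA hi]
  have : (0 : ℝ) ≤ (i : ℝ) / m := by positivity
  nlinarith [abs_nonneg u]

theorem abs_lower_arg_le_upper (hA : 2 * A ≤ m) (hi : i < A) :
    |((i : ℝ) + 1) * (u / m)| ≤ |((m : ℝ) - i) * (u / m)| := by
  rw [abs_mul, abs_mul]
  have h1 : ((2 * i + 1 : ℕ) : ℝ) ≤ m := by exact_mod_cast (by omega : 2 * i + 1 ≤ m)
  push_cast at h1
  refine mul_le_mul_of_nonneg_right ?_ (abs_nonneg _)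
  rw [abs_of_nonneg (by positivity), abs_of_nonneg (by linarith)]
  linarith

/-- Near the origin the product formula can be divided by its denominator, and each quotient of sines
splits into a factor of `m.choose A`, a Gaussian and the remainder. -/
theorem centeredGen_eq_of_abs_le_two (hm : 0 < m) (hA : 2 * A ≤ m) (hu : |u| ≤ 2) :
    centeredGen m A (u / m) =
      ((m.choose A * exp (-(A * (m - A) * (m + 1) / (6 * m ^ 2)) * u ^ 2) *
        exp (-centralRem m A u) : ℝ) : ℂ) := by
  have hm' : (0 : ℝ) < m := by exact_mod_cast hm
  rcases eq_or_ne u 0 with rfl | hu0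
  · simp [centeredGen, centralRem]
  have harg : ∀ i ∈ Finset.range A, |((m : ℝ) - i) * (u / m)| ≤ 2 := fun i hi =>
    (abs_upper_arg_le hm hA (Finset.mem_range.1 hi)).trans hu
  have harg' : ∀ i ∈ Finset.range A, |((i : ℝ) + 1) * (u / m)| ≤ 2 := fun i hi =>
    (abs_lower_arg_le_upper hA (Finset.mem_range.1 hi)).trans (harg i hi)
  have hden : ∏ i ∈ Finset.range A, sin ((i + 1) * (u / m)) ≠ 0 := by
    refine Finset.prod_ne_zero_iff.2 fun i hi => ?_
    rw [sin_eq_mul_exp (harg' i hi)]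
    have : u / m ≠ 0 := div_ne_zero hu0 hm'.ne'
    positivity
  have h1 := centeredGen_mul_prod_sin m A (u / m)
  have h2 : centeredGen m A (u / m) = ((∏ i ∈ Finset.range A,
      (sin ((m - i) * (u / m)) / sin ((i + 1) * (u / m))) : ℝ) : ℂ) := by
    rw [Finset.prod_div_distrib, Complex.ofReal_div, ← h1, mul_div_cancel_right₀]
    exact_mod_cast hden
  rw [h2]
  congr 1
  have h3 : ∀ i ∈ Finset.range A, sin ((m - i) * (u / m)) / sin ((i + 1) * (u / m)) =
      (((m : ℝ) - i) / (i + 1)) * (exp (-((((m : ℝ) - i) ^ 2 - (i + 1) ^ 2) * (u / m) ^ 2 / 6)) *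
        exp (-(sincRem ((m - i) * (u / m)) - sincRem ((i + 1) * (u / m))))) := by
    intro i hi
    rw [sin_eq_mul_exp (harg i hi), sin_eq_mul_exp (harg' i hi)]
    have e1 : -((((m : ℝ) - i) ^ 2 - (i + 1) ^ 2) * (u / m) ^ 2 / 6) =
        -((((m : ℝ) - i) * (u / m)) ^ 2 / 6) - -((((i : ℝ) + 1) * (u / m)) ^ 2 / 6) := by ring
    have e2 : -(sincRem ((m - i) * (u / m)) - sincRem ((i + 1) * (u / m))) =
      -sincRem ((m - i) * (u / m)) - -sincRem ((i + 1) * (u / m)) := by ring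
    rw [e1, e2, exp_sub, exp_sub]
    have : (i : ℝ) + 1 ≠ 0 := by positivity
    field_simp
  rw [Finset.prod_congr rfl h3, Finset.prod_mul_distrib, Finset.prod_mul_distrib,
    prod_sub_div_eq_choose (by omega), ← exp_sum, ← exp_sum, mul_assoc, centralRem,
    Finset.sum_neg_distrib, Finset.sum_neg_distrib, ← Finset.sum_div, ← Finset.sum_mul,
    sum_sq_sub_sq]
  congr 3
  field_simp

/-- Each numerator angle dominates the matching denominator angle, and `sincRem` is increasing. -/
theorem centralRem_nonneg (hm : 0 < m) (hA : 2 * A ≤ m) (hu : |u| ≤ 2) :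
    0 ≤ centralRem m A u :=
  Finset.sum_nonneg fun _ hi => sub_nonneg.2 <| sincRem_mono
    (abs_lower_arg_le_upper hA (Finset.mem_range.1 hi))
    ((abs_upper_arg_le hm hA (Finset.mem_range.1 hi)).trans hu)

end

theorem sincRem_le : ∃ C : ℝ, 0 ≤ C ∧ ∀ x : ℝ, |x| ≤ 2 → sincRem x ≤ C * x ^ 4 := by
  obtain ⟨C, hC, h⟩ := abs_sincRem_sub_le
  refine ⟨1 + 16 * C, by positivity, fun x hx => ?_⟩
  have h1 := (abs_le.1 (h x hx)).2
  have hw : x ^ 2 ≤ 4 := by rw [← sq_abs]; nlinarith [abs_nonneg x]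
  have h4 : 0 ≤ x ^ 4 := by positivity
  have h6 : x ^ 6 ≤ 4 * x ^ 4 := by
    calc x ^ 6 = x ^ 2 * x ^ 4 := by ring
      _ ≤ 4 * x ^ 4 := by gcongr
  have h8 : x ^ 8 ≤ 16 * x ^ 4 := by
    calc x ^ 8 = x ^ 2 * (x ^ 2 * x ^ 4) := by ring
      _ ≤ 4 * (4 * x ^ 4) := by gcongr
      _ = _ := by ring
  have := mul_le_mul_of_nonneg_left h8 hC
  linarith

theorem centralRem_le : ∃ C : ℝ, 0 ≤ C ∧ ∀ (m A : ℕ) (u : ℝ), 0 < m → 2 * A ≤ m → |u| ≤ 2 →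
    centralRem m A u ≤ C * A * u ^ 4 := by
  obtain ⟨C, hC, h⟩ := sincRem_le
  refine ⟨C, hC, fun m A u hm hA hu => ?_⟩
  have : ∀ i ∈ Finset.range A,
      sincRem ((m - i) * (u / m)) - sincRem ((i + 1) * (u / m)) ≤ C * u ^ 4 := by
    intro i hi
    have hi := Finset.mem_range.1 hi
    have h1 := sincRem_nonneg
      ((abs_lower_arg_le_upper (u := u) hA hi).trans ((abs_upper_arg_le hm hA hi).trans hu))
    have h2 := sincRem_mono (abs_upper_arg_le (u := u) hm hA hi) hu
    linarith [h u hu]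
  refine (Finset.sum_le_card_nsmul _ _ _ this).trans_eq ?_
  rw [Finset.card_range, nsmul_eq_mul]
  ring

/-- Up to a relative error `O(A / m)`, all `A` numerator angles equal `u` and the denominator angles
vanish. -/
theorem abs_centralRem_sub_le : ∃ C : ℝ, 0 ≤ C ∧ ∀ (m A : ℕ) (u : ℝ), 0 < m → 2 * A ≤ m →
    |u| ≤ 2 → |centralRem m A u - A * (u ^ 4 / 180 + u ^ 6 / 2835)| ≤
      C * (A * u ^ 8 + A ^ 2 / m * u ^ 4) := by
  obtain ⟨C, hC, h⟩ := abs_sincRem_sub_le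
  obtain ⟨D, hD, h'⟩ := sincRem_le
  refine ⟨C + D + 1, by positivity, fun m A u hm hA hu => ?_⟩
  have hm' : (0 : ℝ) < m := by exact_mod_cast hm
  have hb0 : (0 : ℝ) ≤ (A : ℝ) / m := by positivity
  have hb1 : (A : ℝ) / m ≤ 1 := by
    rw [div_le_one hm']; exact_mod_cast (by omega : A ≤ m)
  have hw : u ^ 2 ≤ 4 := by rw [← sq_abs]; nlinarith [abs_nonneg u]
  have h4 : 0 ≤ u ^ 4 := by positivity
  have h6 : u ^ 6 ≤ 4 * u ^ 4 := by
    calc u ^ 6 = u ^ 2 * u ^ 4 := by ring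
      _ ≤ 4 * u ^ 4 := by gcongr
  have key : ∀ i ∈ Finset.range A,
      |sincRem ((m - i) * (u / m)) - sincRem ((i + 1) * (u / m)) -
        (u ^ 4 / 180 + u ^ 6 / 2835)| ≤ (C + D + 1) * (u ^ 8 + A / m * u ^ 4) := by
    intro i hi
    have hi := Finset.mem_range.1 hi
    have hiA : (i : ℝ) + 1 ≤ A := by exact_mod_cast hi
    have hc : (i : ℝ) / m ≤ A / m := by gcongr
    have hc0 : (0 : ℝ) ≤ (i : ℝ) / m := by positivity
    have hd : ((i : ℝ) + 1) / m ≤ A / m := by gcongr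
    have hv2 := (abs_upper_arg_le (u := u) hm hA hi).trans hu
    have hw2 := (abs_lower_arg_le_upper (u := u) hA hi).trans hv2
    have hwle := h' _ hw2
    have hw0 := sincRem_nonneg hw2
    have hv := h _ hv2
    have even_pow : ∀ (k : ℕ) (x : ℝ), Even k → x ^ k = |x| ^ k := fun k x hk => (hk.pow_abs x).symm
    rw [even_pow 4 (((m : ℝ) - i) * (u / m)) (by decide),
      even_pow 6 (((m : ℝ) - i) * (u / m)) (by decide),
      even_pow 8 (((m : ℝ) - i) * (u / m)) (by decide), abs_upper_arg hm hA hi, mul_pow, mul_pow,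
      mul_pow, (by decide : Even 4).pow_abs, (by decide : Even 6).pow_abs,
      (by decide : Even 8).pow_abs] at hv
    rw [even_pow 4 (((i : ℝ) + 1) * (u / m)) (by decide), abs_lower_arg hm, mul_pow,
      (by decide : Even 4).pow_abs] at hwle
    obtain ⟨c, hcdef⟩ : ∃ c : ℝ, c = (i : ℝ) / m := ⟨_, rfl⟩
    rw [← hcdef] at hv hc hc0
    have b4 : 1 - 4 * c ≤ (1 - c) ^ 4 := by
      have := one_add_mul_le_pow (a := -c) (by linarith) 4
      norm_num at this; linarith
    have b6 : 1 - 6 * c ≤ (1 - c) ^ 6 := by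
      have := one_add_mul_le_pow (a := -c) (by linarith) 6
      norm_num at this; linarith
    have t4 : (1 - c) ^ 4 ≤ 1 := pow_le_one₀ (by linarith) (by linarith)
    have t6 : (1 - c) ^ 6 ≤ 1 := pow_le_one₀ (by linarith) (by linarith)
    have t8 : (1 - c) ^ 8 ≤ 1 := pow_le_one₀ (by linarith) (by linarith)
    have h60 : 0 ≤ u ^ 6 := by positivity
    have h80 : 0 ≤ u ^ 8 := by positivity
    have p4 : (1 - 4 * c) * u ^ 4 ≤ (1 - c) ^ 4 * u ^ 4 := by gcongr
    have p6 : (1 - 6 * c) * u ^ 6 ≤ (1 - c) ^ 6 * u ^ 6 := by gcongr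
    have q4 : (1 - c) ^ 4 * u ^ 4 ≤ 1 * u ^ 4 := by gcongr
    have q6 : (1 - c) ^ 6 * u ^ 6 ≤ 1 * u ^ 6 := by gcongr
    have q8 : C * ((1 - c) ^ 8 * u ^ 8) ≤ C * (1 * u ^ 8) := by gcongr
    have c4 : c * u ^ 4 ≤ A / m * u ^ 4 := by gcongr
    have c6 : c * u ^ 6 ≤ c * (4 * u ^ 4) := by gcongr
    have d4 : D * ((((i : ℝ) + 1) / m) ^ 4 * u ^ 4) ≤ D * ((A : ℝ) / m * u ^ 4) := by
      gcongr
      calc (((i : ℝ) + 1) / m) ^ 4 ≤ ((A : ℝ) / m) ^ 4 := by gcongr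
        _ ≤ (A : ℝ) / m := pow_le_of_le_one hb0 hb1 (by norm_num)
    have hx4 : 0 ≤ A / m * u ^ 4 := by positivity
    have hx1 : 0 ≤ C * (A / m * u ^ 4) := by positivity
    have hx2 : 0 ≤ D * u ^ 8 := by positivity
    have hx3 : 0 ≤ D * (A / m * u ^ 4) := by positivity
    have hx5 : 0 ≤ C * u ^ 8 := by positivity
    have expand : (C + D + 1) * (u ^ 8 + A / m * u ^ 4) = C * u ^ 8 + D * u ^ 8 + u ^ 8 +
        C * (A / m * u ^ 4) + D * (A / m * u ^ 4) + A / m * u ^ 4 := by ring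
    rw [abs_le] at hv ⊢
    rw [expand]
    constructor <;> linarith [hv.1, hv.2]
  have hsum : centralRem m A u - A * (u ^ 4 / 180 + u ^ 6 / 2835) =
      ∑ i ∈ Finset.range A, (sincRem ((m - i) * (u / m)) - sincRem ((i + 1) * (u / m)) -
        (u ^ 4 / 180 + u ^ 6 / 2835)) := by
    rw [Finset.sum_sub_distrib, Finset.sum_const, Finset.card_range, nsmul_eq_mul, centralRem]
  rw [hsum]
  refine (Finset.abs_sum_le_sum_abs _ _).trans ((Finset.sum_le_card_nsmul _ _ _ key).trans_eq ?_)
  rw [Finset.card_range, nsmul_eq_mul]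
  ring

/-! ### The central part of the Fourier integral -/

theorem abs_exp_neg_sub_taylor_le {x : ℝ} (hx : 0 ≤ x) :
    |exp (-x) - (1 - x + x ^ 2 / 2)| ≤ x ^ 3 := by
  rcases le_or_gt x 1 with h1 | h1
  · have h := Real.exp_bound (x := -x) (by rwa [abs_neg, abs_of_nonneg hx]) (n := 3) (by norm_num)
    rw [abs_neg, abs_of_nonneg hx] at h
    simp only [Finset.sum_range_succ, Finset.sum_range_zero, Nat.factorial] at h
    norm_num at h
    have h3 : 0 ≤ x ^ 3 := by positivity
    rw [show 1 - x + x ^ 2 / 2 = 1 + -x + x ^ 2 / 2 by ring]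
    linarith
  · have h2 : exp (-x) ≤ 1 := exp_le_one_iff.2 (by linarith)
    have h3 := exp_pos (-x)
    have h4 : x ^ 2 ≤ x ^ 3 := pow_le_pow_right₀ h1.le (by norm_num)
    have h5 : x ≤ x ^ 2 := by nlinarith
    rw [abs_le]
    constructor <;> linarith

/-- The coefficient of the quadratic term: `centeredGen m A (u / m)` is approximately
`m.choose A * exp (-gaussRate m A * u ^ 2)`. -/
def gaussRate (m A : ℕ) : ℝ := A * (m - A) * (m + 1) / (6 * m ^ 2)

theorem le_gaussRate {m A : ℕ} (hm : 0 < m) (hA : 2 * A ≤ m) : (A : ℝ) / 12 ≤ gaussRate m A := by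
  have hm' : (0 : ℝ) < m := by exact_mod_cast hm
  have hA' : 2 * (A : ℝ) ≤ m := by exact_mod_cast hA
  rw [gaussRate, div_le_div_iff₀ (by norm_num) (by positivity)]
  have h1 : (m : ℝ) / 2 * m ≤ (m - A) * (m + 1) :=
    mul_le_mul (by linarith) (by linarith) hm'.le (by linarith)
  have h0 : (0 : ℝ) ≤ A := A.cast_nonneg
  nlinarith

/-- The Edgeworth polynomial approximating `exp (-centralRem m A u)`. -/
def edgeworthPoly (a u : ℝ) : ℝ :=
  1 - a / 180 * u ^ 4 - a / 2835 * u ^ 6 + a ^ 2 / 64800 * u ^ 8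

/-- The error of `edgeworthPoly`, uniformly on the whole line; the powers of `u` are chosen such
that after integration against the Gaussian weight each term is `O(1 / A ^ 3 + 1 / m)`. -/
def edgeworthErr (m A : ℕ) (u : ℝ) : ℝ :=
  u ^ 6 + A * u ^ 8 + A ^ 2 * u ^ 10 + A ^ 3 * u ^ 12 + A ^ 2 / m * u ^ 4 + A ^ 3 / m * u ^ 8

theorem abs_exp_neg_centralRem_sub_le : ∃ C : ℝ, 0 ≤ C ∧ ∀ (m A : ℕ) (u : ℝ), 0 < m → 2 * A ≤ m →
    |u| ≤ 2 → |exp (-centralRem m A u) - edgeworthPoly A u| ≤ C * edgeworthErr m A u := by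
  obtain ⟨C, hC, h⟩ := abs_centralRem_sub_le
  obtain ⟨D, hD, h'⟩ := centralRem_le
  refine ⟨D ^ 3 + C + (1 + 4 * C) * (D + 1), by positivity, fun m A u hm hA hu => ?_⟩
  have hm' : (0 : ℝ) < m := by exact_mod_cast hm
  have hX0 := centralRem_nonneg hm hA hu
  have hX1 := h' m A u hm hA hu
  have hX2 := h m A u hm hA hu
  have hexp := abs_exp_neg_sub_taylor_le hX0
  have hw : u ^ 2 ≤ 4 := by rw [← sq_abs]; nlinarith [abs_nonneg u]
  have hw0 : 0 ≤ u ^ 2 := sq_nonneg u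
  obtain ⟨X, hX⟩ : ∃ X, X = centralRem m A u := ⟨_, rfl⟩
  rw [← hX] at hX0 hX1 hX2 hexp ⊢
  obtain ⟨a, ha⟩ : ∃ a : ℝ, a = A := ⟨_, rfl⟩
  have ha0 : 0 ≤ a := ha ▸ A.cast_nonneg
  rw [edgeworthErr]
  rw [← ha] at hX1 hX2 ⊢
  have hX3 : X ^ 3 ≤ D ^ 3 * (a ^ 3 * u ^ 12) := by
    calc X ^ 3 ≤ (D * a * u ^ 4) ^ 3 := by gcongr
      _ = _ := by ring
  have h86 : a * u ^ 8 ≤ 4 * (a * u ^ 6) := by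
    calc a * u ^ 8 = u ^ 2 * (a * u ^ 6) := by ring
      _ ≤ 4 * (a * u ^ 6) := by gcongr
  have hd : |X - a / 180 * u ^ 4| ≤ (1 + 4 * C) * (a * u ^ 6 + a ^ 2 / m * u ^ 4) := by
    have e : X - a / 180 * u ^ 4 = (X - a * (u ^ 4 / 180 + u ^ 6 / 2835)) + a * u ^ 6 / 2835 := by
      ring
    rw [e]
    refine (abs_add_le _ _).trans ?_
    have h6 : 0 ≤ a * u ^ 6 := by positivity
    have h4 : 0 ≤ a ^ 2 / m * u ^ 4 := by positivity
    rw [abs_of_nonneg (by positivity : 0 ≤ a * u ^ 6 / 2835)]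
    have := mul_le_mul_of_nonneg_left h86 hC
    have h5 : 0 ≤ C * (a ^ 2 / m * u ^ 4) := by positivity
    linarith
  have hs : |X + a / 180 * u ^ 4| ≤ (D + 1) * (a * u ^ 4) := by
    have h4 : 0 ≤ a * u ^ 4 := by positivity
    rw [abs_of_nonneg (by positivity)]
    linarith
  have hsq : |X ^ 2 / 2 - (a / 180 * u ^ 4) ^ 2 / 2| ≤
      (1 + 4 * C) * (D + 1) * (a ^ 2 * u ^ 10 + a ^ 3 / m * u ^ 8) := by
    have e : X ^ 2 / 2 - (a / 180 * u ^ 4) ^ 2 / 2 =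
        (X - a / 180 * u ^ 4) * (X + a / 180 * u ^ 4) / 2 := by ring
    rw [e, abs_div, abs_mul, abs_of_pos (by norm_num : (0 : ℝ) < 2)]
    have h1 := mul_le_mul hd hs (abs_nonneg _) (by positivity)
    have h2 : (1 + 4 * C) * (a * u ^ 6 + a ^ 2 / m * u ^ 4) * ((D + 1) * (a * u ^ 4)) =
      (1 + 4 * C) * (D + 1) * (a ^ 2 * u ^ 10 + a ^ 3 / m * u ^ 8) := by ring
    rw [h2] at h1
    have h3 : 0 ≤ (1 + 4 * C) * (D + 1) * (a ^ 2 * u ^ 10 + a ^ 3 / m * u ^ 8) := by positivity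
    linarith
  have e : exp (-X) - edgeworthPoly a u = (exp (-X) - (1 - X + X ^ 2 / 2)) -
      (X - a * (u ^ 4 / 180 + u ^ 6 / 2835)) + (X ^ 2 / 2 - (a / 180 * u ^ 4) ^ 2 / 2) := by
    rw [edgeworthPoly]; ring
  rw [e]
  refine ((abs_add_le _ _).trans (add_le_add_left (abs_sub _ _) _)).trans ?_
  obtain ⟨P, hP⟩ : ∃ P, P = D ^ 3 := ⟨_, rfl⟩
  obtain ⟨Q, hQ⟩ : ∃ Q, Q = (1 + 4 * C) * (D + 1) := ⟨_, rfl⟩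
  have hP0 : 0 ≤ P := by rw [hP]; positivity
  have hQ0 : 0 ≤ Q := by rw [hQ]; positivity
  rw [← hP] at hX3 ⊢
  rw [← hQ] at hsq ⊢
  have hpos : 0 ≤ (C + Q) * (a ^ 3 * u ^ 12) + (P + Q) * (a * u ^ 8 + a ^ 2 / m * u ^ 4) +
      (P + C) * (a ^ 2 * u ^ 10 + a ^ 3 / m * u ^ 8) + (P + C + Q) * u ^ 6 := by positivity
  calc _ ≤ P * (a ^ 3 * u ^ 12) + C * (a * u ^ 8 + a ^ 2 / m * u ^ 4) +
        Q * (a ^ 2 * u ^ 10 + a ^ 3 / m * u ^ 8) :=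
      add_le_add (add_le_add (hexp.trans hX3) hX2) hsq
    _ ≤ _ := by linarith

/-- Outside the central interval the Edgeworth polynomial is itself an admissible error, which allows
integration over the whole line. -/
theorem abs_edgeworthPoly_le_of_two_lt {m A : ℕ} {u : ℝ} (hu : 2 < |u|) :
    |edgeworthPoly A u| ≤ edgeworthErr m A u := by
  have hw : 1 ≤ u ^ 2 := by rw [← sq_abs]; nlinarith
  have hA : (0 : ℝ) ≤ A := A.cast_nonneg
  have h6 : 1 ≤ u ^ 6 := by
    calc (1 : ℝ) ≤ (u ^ 2) ^ 3 := one_le_pow₀ hw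
      _ = u ^ 6 := by ring
  have h48 : A * u ^ 4 ≤ A * u ^ 8 := by
    calc A * u ^ 4 = 1 * 1 * (A * u ^ 4) := by ring
      _ ≤ u ^ 2 * u ^ 2 * (A * u ^ 4) := by gcongr
      _ = _ := by ring
  have h68 : A * u ^ 6 ≤ A * u ^ 8 := by
    calc A * u ^ 6 = 1 * (A * u ^ 6) := by ring
      _ ≤ u ^ 2 * (A * u ^ 6) := by gcongr
      _ = _ := by ring
  have h810 : (A : ℝ) ^ 2 * u ^ 8 ≤ A ^ 2 * u ^ 10 := by
    calc (A : ℝ) ^ 2 * u ^ 8 = 1 * (A ^ 2 * u ^ 8) := by ring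
      _ ≤ u ^ 2 * (A ^ 2 * u ^ 8) := by gcongr
      _ = _ := by ring
  have p4 : 0 ≤ A * u ^ 4 := by positivity
  have p6 : 0 ≤ A * u ^ 6 := by positivity
  have p8 : 0 ≤ (A : ℝ) ^ 2 * u ^ 8 := by positivity
  have p12 : 0 ≤ (A : ℝ) ^ 3 * u ^ 12 := by positivity
  have q4 : 0 ≤ (A : ℝ) ^ 2 / m * u ^ 4 := by positivity
  have q8 : 0 ≤ (A : ℝ) ^ 3 / m * u ^ 8 := by positivity
  rw [abs_le, edgeworthPoly, edgeworthErr]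
  constructor <;> linarith

/-- The moment of order `2 k` of the Gaussian weight `exp (-b x ^ 2)`. -/
theorem integrable_and_moment {b : ℝ} (hb : 0 < b) (k : ℕ) (c : ℝ) :
    Integrable (fun x : ℝ => c * x ^ (2 * k) * exp (-b * x ^ 2)) ∧
    ∫ x : ℝ, c * x ^ (2 * k) * exp (-b * x ^ 2) =
      √(π / b) * (c * (Nat.doubleFactorial (2 * k - 1) / (2 * b) ^ k)) := by
  simp_rw [mul_assoc c]
  refine ⟨(integrable_pow_mul_exp_neg_mul_sq hb _).const_mul c, ?_⟩
  rw [integral_const_mul, integral_pow_two_mul_mul_exp_neg_mul_sq hb]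
  ring

theorem integrable_and_integral_add {f g : ℝ → ℝ} {x y : ℝ} (hf : Integrable f ∧ ∫ u, f u = x)
    (hg : Integrable g ∧ ∫ u, g u = y) :
    Integrable (fun u => f u + g u) ∧ ∫ u, (f u + g u) = x + y :=
  ⟨hf.1.add hg.1, by rw [integral_add hf.1 hg.1, hf.2, hg.2]⟩

theorem integral_edgeworthPoly {b : ℝ} (hb : 0 < b) (a : ℝ) :
    Integrable (fun u => edgeworthPoly a u * exp (-b * u ^ 2)) ∧
    ∫ u, edgeworthPoly a u * exp (-b * u ^ 2) = √(π / b) *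
      (1 - a / 180 * (3 / (2 * b) ^ 2) - a / 2835 * (15 / (2 * b) ^ 3) +
        a ^ 2 / 64800 * (105 / (2 * b) ^ 4)) := by
  have h0 := integrable_and_moment hb 0 1
  have h2 := integrable_and_moment hb 2 (-(a / 180))
  have h3 := integrable_and_moment hb 3 (-(a / 2835))
  have h4 := integrable_and_moment hb 4 (a ^ 2 / 64800)
  have e : (fun u => edgeworthPoly a u * exp (-b * u ^ 2)) = fun u =>
      1 * u ^ (2 * 0) * exp (-b * u ^ 2) + -(a / 180) * u ^ (2 * 2) * exp (-b * u ^ 2) +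
      -(a / 2835) * u ^ (2 * 3) * exp (-b * u ^ 2) +
      a ^ 2 / 64800 * u ^ (2 * 4) * exp (-b * u ^ 2) := by
    funext u; rw [edgeworthPoly]; ring
  rw [e]
  have h := integrable_and_integral_add (integrable_and_integral_add
    (integrable_and_integral_add h0 h2) h3) h4
  refine ⟨h.1, h.2.trans ?_⟩
  simp [Nat.doubleFactorial]
  ring

theorem integral_edgeworthErr {b : ℝ} (hb : 0 < b) (m A : ℕ) :
    Integrable (fun u => edgeworthErr m A u * exp (-b * u ^ 2)) ∧
    ∫ u, edgeworthErr m A u * exp (-b * u ^ 2) = √(π / b) *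
      (15 / (2 * b) ^ 3 + A * (105 / (2 * b) ^ 4) + A ^ 2 * (945 / (2 * b) ^ 5) +
        A ^ 3 * (10395 / (2 * b) ^ 6) + A ^ 2 / m * (3 / (2 * b) ^ 2) +
        A ^ 3 / m * (105 / (2 * b) ^ 4)) := by
  have h1 := integrable_and_moment hb 3 1
  have h2 := integrable_and_moment hb 4 A
  have h3 := integrable_and_moment hb 5 (A ^ 2)
  have h4 := integrable_and_moment hb 6 (A ^ 3)
  have h5 := integrable_and_moment hb 2 (A ^ 2 / m)
  have h6 := integrable_and_moment hb 4 (A ^ 3 / m)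
  have e : (fun u => edgeworthErr m A u * exp (-b * u ^ 2)) = fun u =>
      1 * u ^ (2 * 3) * exp (-b * u ^ 2) + A * u ^ (2 * 4) * exp (-b * u ^ 2) +
      A ^ 2 * u ^ (2 * 5) * exp (-b * u ^ 2) + A ^ 3 * u ^ (2 * 6) * exp (-b * u ^ 2) +
      A ^ 2 / m * u ^ (2 * 2) * exp (-b * u ^ 2) + A ^ 3 / m * u ^ (2 * 4) * exp (-b * u ^ 2) := by
    funext u; rw [edgeworthErr]; ring
  rw [e]
  have h := integrable_and_integral_add (integrable_and_integral_add (integrable_and_integral_add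
    (integrable_and_integral_add (integrable_and_integral_add h1 h2) h3) h4) h5) h6
  refine ⟨h.1, h.2.trans ?_⟩
  simp [Nat.doubleFactorial]
  ring

/-- The contribution of `|t| ≤ 2 / m` to the Fourier integral, rescaled by `u = m t`. -/
def centralIntegral (m A : ℕ) : ℝ := ∫ u in (-2 : ℝ)..2, (centeredGen m A (u / m)).re

/-- The central integral, normalised by its leading Gaussian term, is the normalised Gaussian mean of
the Edgeworth polynomial up to `O(1 / A ^ 3 + 1 / m)`. -/
theorem abs_centralIntegral_sub_le : ∃ C : ℝ, 0 ≤ C ∧ ∀ m A : ℕ, 0 < A → 2 * A ≤ m →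
    |√(gaussRate m A) / √π * (centralIntegral m A / m.choose A) -
      (1 - A / 180 * (3 / (2 * gaussRate m A) ^ 2) - A / 2835 * (15 / (2 * gaussRate m A) ^ 3) +
        A ^ 2 / 64800 * (105 / (2 * gaussRate m A) ^ 4))| ≤ C * (1 / (A : ℝ) ^ 3 + 1 / m) := by
  obtain ⟨C, hC, h⟩ := abs_exp_neg_centralRem_sub_le
  -- `10 ^ 10` exceeds the sum of the moments of `edgeworthErr` at the smallest possible rate
  refine ⟨(C + 1) * 10 ^ 10, by positivity, fun m A hA0 hA => ?_⟩
  have hm : 0 < m := by omega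
  have hm' : (0 : ℝ) < m := by exact_mod_cast hm
  have hA0' : (0 : ℝ) < A := by exact_mod_cast hA0
  have hbA := le_gaussRate hm hA
  obtain ⟨b, hbdef⟩ : ∃ b, b = gaussRate m A := ⟨_, rfl⟩
  rw [← hbdef] at hbA ⊢
  have hb : 0 < b := by have : 0 < (A : ℝ) / 12 := by positivity
                        linarith
  have hch : (0 : ℝ) < m.choose A := by exact_mod_cast Nat.choose_pos (by omega)
  let g : ℝ → ℝ := fun u => (centeredGen m A (u / m)).re / m.choose A
  have hg : Continuous g :=
    (Complex.continuous_re.comp ((continuous_centeredGen m A).comp (by fun_prop))).div_const _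
  have hgeq : ∀ u, |u| ≤ 2 → g u = exp (-b * u ^ 2) * exp (-centralRem m A u) := by
    intro u hu
    simp only [g]
    rw [centeredGen_eq_of_abs_le_two hm hA hu, Complex.ofReal_re, hbdef, gaussRate]
    field_simp
  have hJ : centralIntegral m A / m.choose A = ∫ u, (Set.Ioc (-2 : ℝ) 2).indicator g u := by
    rw [integral_indicator measurableSet_Ioc, ← intervalIntegral.integral_of_le (by norm_num),
      centralIntegral, ← intervalIntegral.integral_div]
  have hgi : Integrable ((Set.Ioc (-2 : ℝ) 2).indicator g) :=
    (integrable_indicator_iff measurableSet_Ioc).2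
      ((hg.continuousOn.integrableOn_Icc).mono_set Set.Ioc_subset_Icc_self)
  have hP := integral_edgeworthPoly hb A
  have hE := integral_edgeworthErr hb m A
  have hE0 : ∀ u, 0 ≤ edgeworthErr m A u := by
    intro u; rw [edgeworthErr]; positivity
  have hbound : ‖∫ u, ((Set.Ioc (-2 : ℝ) 2).indicator g u - edgeworthPoly A u * exp (-b * u ^ 2))‖ ≤
      ∫ u, (C + 1) * (edgeworthErr m A u * exp (-b * u ^ 2)) := by
    refine norm_integral_le_of_norm_le (hE.1.const_mul _) ?_
    have hne : ∀ᵐ u : ℝ, u ≠ -2 := by simp [ae_iff]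
    filter_upwards [hne] with u hu2
    by_cases hu : u ∈ Set.Ioc (-2 : ℝ) 2
    · have hu' : |u| ≤ 2 := abs_le.2 ⟨hu.1.le, hu.2⟩
      rw [Set.indicator_of_mem hu, hgeq u hu', mul_comm (exp _), ← sub_mul, norm_mul,
        norm_of_nonneg (exp_pos _).le, ← mul_assoc, Real.norm_eq_abs]
      refine mul_le_mul_of_nonneg_right ((h m A u hm hA hu').trans ?_) (exp_pos _).le
      linarith [hE0 u]
    · have hu' : 2 < |u| := by
        by_contra hcon
        push Not at hcon
        obtain ⟨h1, h2⟩ := abs_le.1 hcon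
        exact hu ⟨lt_of_le_of_ne h1 (Ne.symm hu2), h2⟩
      rw [Set.indicator_of_notMem hu, zero_sub, norm_neg, norm_mul,
        norm_of_nonneg (exp_pos _).le, ← mul_assoc, Real.norm_eq_abs]
      refine mul_le_mul_of_nonneg_right ((abs_edgeworthPoly_le_of_two_lt (m := m) hu').trans ?_)
        (exp_pos _).le
      nlinarith [hE0 u, mul_nonneg hC (hE0 u)]
  rw [integral_sub hgi hP.1, ← hJ, hP.2, integral_const_mul, hE.2, Real.norm_eq_abs] at hbound
  have hs : √b / √π * √(π / b) = 1 := by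
    rw [sqrt_div pi_pos.le]
    have h1 := sqrt_pos.2 hb
    have h2 := sqrt_pos.2 pi_pos
    field_simp
  have hs0 : 0 ≤ √b / √π := by positivity
  have h1 := mul_le_mul_of_nonneg_left hbound hs0
  rw [← abs_of_nonneg hs0, ← abs_mul, abs_of_nonneg hs0, mul_sub, ← mul_assoc _ √(π / b), hs,
    one_mul, mul_left_comm, ← mul_assoc _ √(π / b), hs, one_mul] at h1
  refine h1.trans ?_
  rw [mul_assoc]
  refine mul_le_mul_of_nonneg_left ?_ (by positivity)
  -- every moment is at most its value at the lower bound `A / 12` of the rate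
  have hp : ∀ (c : ℝ) (k : ℕ), 0 ≤ c → c / (2 * b) ^ k ≤ c / ((A : ℝ) / 6) ^ k := by
    intro c k hc
    gcongr
    linarith
  have i1 := hp 15 3 (by norm_num)
  have i2 := mul_le_mul_of_nonneg_left (hp 105 4 (by norm_num)) hA0'.le
  have i3 := mul_le_mul_of_nonneg_left (hp 945 5 (by norm_num)) (sq_nonneg (A : ℝ))
  have i4 := mul_le_mul_of_nonneg_left (hp 10395 6 (by norm_num)) (pow_nonneg hA0'.le 3)
  have i5 := mul_le_mul_of_nonneg_left (hp 3 2 (by norm_num))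
    (by positivity : (0 : ℝ) ≤ (A : ℝ) ^ 2 / m)
  have i6 := mul_le_mul_of_nonneg_left (hp 105 4 (by norm_num))
    (by positivity : (0 : ℝ) ≤ (A : ℝ) ^ 3 / m)
  have e1 : (15 : ℝ) / ((A : ℝ) / 6) ^ 3 + A * (105 / ((A : ℝ) / 6) ^ 4) +
      A ^ 2 * (945 / ((A : ℝ) / 6) ^ 5) + A ^ 3 * (10395 / ((A : ℝ) / 6) ^ 6) +
      A ^ 2 / m * (3 / ((A : ℝ) / 6) ^ 2) + A ^ 3 / m * (105 / ((A : ℝ) / 6) ^ 4) =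
      (15 * 6 ^ 3 + 105 * 6 ^ 4 + 945 * 6 ^ 5 + 10395 * 6 ^ 6) * (1 / (A : ℝ) ^ 3) +
      108 * (1 / m) + 105 * 6 ^ 4 * (1 / m) * (1 / (A : ℝ)) := by
    field_simp
    ring
  have hAle : 1 / (A : ℝ) ≤ 1 := by
    rw [div_le_one hA0']; exact_mod_cast hA0
  have hm1 : 0 < 1 / (m : ℝ) := by positivity
  have hA3 : 0 < 1 / (A : ℝ) ^ 3 := by positivity
  have i7 : 1 / (m : ℝ) * (1 / A) ≤ 1 / m * 1 := by gcongr
  linarith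

/-! ### Negligibility of the rest of the Fourier integral -/

/-- The weight that a set of `A` elements of `{1, …, m}` receives when each element is selected
with probability `A / m`. -/
def setWeight (m A : ℕ) : ℝ := ((A : ℝ) / m) ^ A * (1 - (A : ℝ) / m) ^ (m - A)

/-- Cauchy's estimate with radius `K A / m`, where `1 / |sin t| ≤ m / K`. The exponentials of size
`exp (± A)` cancel against the weight, and `K ^ (-A)` remains. -/
theorem setWeight_mul_norm_le {m A : ℕ} {t K : ℝ} (hA : 2 ≤ A) (hAm : 32 * A ≤ m)
    (hK : 5 / 4 ≤ K) (hKt : K ≤ m * |sin t|) (hK2 : (A : ℝ) / m * K ^ 2 ≤ 1 / 16) :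
    setWeight m A * ‖centeredGen m A t‖ ≤ (9 / 10) ^ A * (2 / K ^ 2) := by
  have hm' : (0 : ℝ) < m := by exact_mod_cast (by omega : 0 < m)
  have hA' : (0 : ℝ) < A := by exact_mod_cast (by omega : 0 < A)
  have hK0 : 0 < K := by linarith
  obtain ⟨b, hb⟩ : ∃ b, b = (A : ℝ) / m := ⟨_, rfl⟩
  have hb0 : 0 < b := by rw [hb]; positivity
  have hbm : m * b = A := by rw [hb]; field_simp
  have hb1 : b ≤ 1 / 32 := by
    rw [hb, div_le_div_iff₀ hm' (by norm_num)]
    have : 32 * (A : ℝ) ≤ m := by exact_mod_cast hAm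
    linarith
  rw [← hb] at hK2
  have h1 := norm_centeredGen_mul_pow_le m A t (r := K * b) (P := m / K) (by positivity) (by
    rw [div_mul_eq_mul_div, le_div_iff₀ hK0]; linarith)
  have h2 : K * b * (m / K) + m * (K * b) ^ 2 / 2 = A + A * (b * K ^ 2) / 2 := by
    rw [← hbm]; field_simp
  rw [h2, mul_pow] at h1
  have h3 : (1 - b) ^ (m - A) ≤ exp (-A + A * b) := by
    calc (1 - b) ^ (m - A) ≤ exp (-b) ^ (m - A) :=
          pow_le_pow_left₀ (by linarith) (one_sub_le_exp_neg b) _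
      _ = exp (-A + A * b) := by
          rw [← exp_nat_mul, Nat.cast_sub (by omega), ← hbm]; ring_nf
  have h4 : exp (A + A * (b * K ^ 2) / 2) * exp (-A + A * b) ≤ (16 / 15) ^ A := by
    have h5 : exp (1 / 16 : ℝ) ≤ 16 / 15 := by
      have := one_sub_le_exp_neg (1 / 16 : ℝ)
      rw [exp_neg] at this
      have h6 := exp_pos (1 / 16 : ℝ)
      rw [le_inv_comm₀ (by norm_num) h6] at this
      norm_num at this ⊢
      exact this
    rw [← exp_add]
    calc _ ≤ exp (A * (1 / 16)) := exp_le_exp.2 (by nlinarith)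
      _ = exp (1 / 16) ^ A := by rw [← exp_nat_mul]
      _ ≤ _ := pow_le_pow_left₀ (exp_pos _).le h5 _
  have h7 : setWeight m A * ‖centeredGen m A t‖ * K ^ A ≤ (16 / 15) ^ A := by
    rw [setWeight, ← hb]
    have h9 : (0 : ℝ) ≤ (1 - b) ^ (m - A) := pow_nonneg (by linarith) _
    calc b ^ A * (1 - b) ^ (m - A) * ‖centeredGen m A t‖ * K ^ A
        = ‖centeredGen m A t‖ * (K ^ A * b ^ A) * (1 - b) ^ (m - A) := by ring
      _ ≤ exp (A + A * (b * K ^ 2) / 2) * exp (-A + A * b) := by gcongr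
      _ ≤ _ := h4
  have h8 : (5 / 4 : ℝ) ^ (A - 2) * K ^ 2 ≤ K ^ A := by
    calc (5 / 4 : ℝ) ^ (A - 2) * K ^ 2 ≤ K ^ (A - 2) * K ^ 2 := by gcongr
      _ = K ^ A := by rw [← pow_add]; congr 1; omega
  have hw0 : 0 ≤ setWeight m A * ‖centeredGen m A t‖ := by
    rw [setWeight, ← hb]
    have h9 : (0 : ℝ) ≤ (1 - b) ^ (m - A) := pow_nonneg (by linarith) _
    positivity
  have h10 : (5 / 4 : ℝ) ^ A = (5 / 4) ^ (A - 2) * (25 / 16) := by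
    have : (25 / 16 : ℝ) = (5 / 4) ^ 2 := by norm_num
    rw [this, ← pow_add]; congr 1; omega
  have h11 : setWeight m A * ‖centeredGen m A t‖ * K ^ 2 * (5 / 4) ^ A ≤ 2 * (16 / 15) ^ A := by
    rw [h10]
    have h12 := mul_le_mul_of_nonneg_left h8 hw0
    have h13 : (0 : ℝ) ≤ (16 / 15) ^ A := by positivity
    nlinarith
  have h14 : (16 / 15 : ℝ) ^ A ≤ (9 / 10) ^ A * (5 / 4) ^ A := by
    rw [← mul_pow]; gcongr; norm_num
  rw [mul_div_assoc', le_div_iff₀ (by positivity)]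
  have h15 : (0 : ℝ) < (5 / 4) ^ A := by positivity
  refine le_of_mul_le_mul_right (h11.trans ?_) h15
  linarith

theorem two_mul_div_pi_le_abs_sin {t : ℝ} (ht : |t| ≤ π / 2) : 2 / π * |t| ≤ |sin t| := by
  have h : |sin (|t|)| = |sin t| := by
    rcases abs_choice t with h | h <;> rw [h]
    rw [sin_neg, abs_neg]
  rw [← h]
  exact (mul_le_sin (abs_nonneg t) ht).trans (le_abs_self _)

/-- The decay of the generating function away from the origin. The term `1 / (1 + (m t) ^ 2)` makes the
integral over `t` of order `1 / m`, however small `A` is compared with `m`. -/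
theorem setWeight_mul_norm_le_of_two_le {m A : ℕ} {t : ℝ} (hA : 2 ≤ A) (hAm : 32 * A ≤ m)
    (ht : 2 ≤ m * |t|) (ht' : |t| ≤ π / 2) :
    setWeight m A * ‖centeredGen m A t‖ ≤
      (9 / 10) ^ A * (10 * (1 + (m * t) ^ 2)⁻¹ + 32 * (A / m)) := by
  have hm' : (0 : ℝ) < m := by exact_mod_cast (by omega : 0 < m)
  have hA' : (0 : ℝ) < A := by exact_mod_cast (by omega : 0 < A)
  obtain ⟨b, hb⟩ : ∃ b, b = (A : ℝ) / m := ⟨_, rfl⟩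
  have hb0 : 0 < b := by rw [hb]; positivity
  have hb1 : b ≤ 1 / 32 := by
    rw [hb, div_le_div_iff₀ hm' (by norm_num)]
    have : 32 * (A : ℝ) ≤ m := by exact_mod_cast hAm
    linarith
  have hsin := mul_le_mul_of_nonneg_left (two_mul_div_pi_le_abs_sin ht') hm'.le
  obtain ⟨L, hL⟩ : ∃ L, L = 2 / π * (m * |t|) := ⟨_, rfl⟩
  have hLsin : L ≤ m * |sin t| := by rw [hL]; linarith
  have h58 : 5 / 8 ≤ 2 / π := by
    rw [div_le_div_iff₀ (by norm_num) pi_pos]; linarith [pi_lt_d2]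
  have hL54 : 5 / 4 ≤ L := by
    rw [hL]
    calc (5 / 4 : ℝ) = 5 / 8 * 2 := by norm_num
      _ ≤ _ := by gcongr
  have hsq : (m * t) ^ 2 = (m * |t|) ^ 2 := by rw [mul_pow, mul_pow, sq_abs]
  have h4 : 4 ≤ (m * t) ^ 2 := by rw [hsq]; nlinarith
  have hL2 : 25 / 64 * (m * t) ^ 2 ≤ L ^ 2 := by
    rw [hL, hsq, mul_pow (2 / π)]
    refine mul_le_mul_of_nonneg_right ?_ (sq_nonneg _)
    exact le_trans (by norm_num) (pow_le_pow_left₀ (by norm_num) h58 2)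
  rw [← hb]
  have hpos : 0 < (1 + (m * t) ^ 2)⁻¹ := by positivity
  by_cases hc : b * L ^ 2 ≤ 1 / 16
  · refine (setWeight_mul_norm_le hA hAm hL54 hLsin (hb ▸ hc)).trans ?_
    gcongr
    have h5 : 2 / L ^ 2 ≤ 10 * (1 + (m * t) ^ 2)⁻¹ := by
      rw [← div_eq_mul_inv, div_le_div_iff₀ (by positivity) (by positivity)]
      linarith
    linarith
  · push Not at hc
    -- here the radius is limited by the quadratic term, not by the power sum
    obtain ⟨K, hK⟩ : ∃ K, K = 1 / (4 * √b) := ⟨_, rfl⟩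
    have hsb := sqrt_pos.2 hb0
    have hK0 : 0 < K := by rw [hK]; positivity
    have hKsq : b * K ^ 2 = 1 / 16 := by
      rw [hK, div_pow, mul_pow, sq_sqrt hb0.le]; field_simp; norm_num
    have hKL : K ≤ L := by
      refine le_of_sq_le_sq ?_ (by linarith)
      refine le_of_mul_le_mul_left ?_ hb0
      linarith
    have hK54 : 5 / 4 ≤ K := by
      refine le_of_sq_le_sq ?_ hK0.le
      have : 1 / 16 ≤ 1 / 32 * K ^ 2 := by rw [← hKsq]; gcongr
      linarith
    refine (setWeight_mul_norm_le hA hAm hK54 (hKL.trans hLsin) (hb ▸ hKsq.le)).trans ?_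
    gcongr
    have h6 : 2 / K ^ 2 = 32 * b := by
      rw [div_eq_iff (by positivity)]; linarith
    rw [h6]
    linarith

theorem integral_inv_one_add_mul_sq_le {c a b : ℝ} (hc : 0 < c) :
    ∫ t in a..b, (1 + (c * t) ^ 2)⁻¹ ≤ π / c := by
  rw [intervalIntegral.integral_comp_mul_left (fun x => (1 + x ^ 2)⁻¹) hc.ne',
    integral_inv_one_add_sq, smul_eq_mul, inv_mul_eq_div]
  gcongr
  linarith [arctan_lt_pi_div_two (c * b), neg_pi_div_two_lt_arctan (c * a)]

theorem setWeight_nonneg {m A : ℕ} (h : A ≤ m) : 0 ≤ setWeight m A := by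
  rw [setWeight]
  have h1 : (A : ℝ) / m ≤ 1 := div_le_one_of_le₀ (by exact_mod_cast h) m.cast_nonneg
  have : (0 : ℝ) ≤ (1 - (A : ℝ) / m) ^ (m - A) := pow_nonneg (by linarith) _
  positivity

theorem setWeight_mul_abs_integral_le {m A : ℕ} {a b : ℝ} (hA : 2 ≤ A) (hAm : 32 * A ≤ m)
    (hab : a ≤ b) (ha : -(π / 2) ≤ a) (hb : b ≤ π / 2) (h : ∀ t ∈ Set.Ioc a b, 2 ≤ m * |t|) :
    setWeight m A * |∫ t in a..b, (centeredGen m A t).re| ≤ (9 / 10) ^ A * (200 * A / m) := by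
  have hm' : (0 : ℝ) < m := by exact_mod_cast (by omega : 0 < m)
  have hA' : (1 : ℝ) ≤ A := by exact_mod_cast (by omega : 1 ≤ A)
  have hw := setWeight_nonneg (m := m) (A := A) (by omega)
  have hcont : Continuous fun t : ℝ => (1 + (m * t) ^ 2)⁻¹ :=
    Continuous.inv₀ (by fun_prop) fun t => by positivity
  have hle := intervalIntegral.norm_integral_le_of_norm_le hab (μ := volume)
    (f := fun t => setWeight m A * (centeredGen m A t).re)
    (g := fun t => (9 / 10) ^ A * (10 * (1 + (m * t) ^ 2)⁻¹ + 32 * ((A : ℝ) / m)))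
    (Eventually.of_forall fun t ht => by
      have ht' : |t| ≤ π / 2 := abs_le.2 ⟨ha.trans ht.1.le, ht.2.trans hb⟩
      refine le_trans ?_ (setWeight_mul_norm_le_of_two_le hA hAm (h t ht) ht')
      rw [norm_mul, norm_of_nonneg hw, Real.norm_eq_abs]
      exact mul_le_mul_of_nonneg_left (Complex.abs_re_le_norm _) hw)
    ((by fun_prop : Continuous fun t : ℝ =>
      (9 / 10 : ℝ) ^ A * (10 * (1 + (m * t) ^ 2)⁻¹ + 32 * ((A : ℝ) / m))).intervalIntegrable _ _)
  rw [intervalIntegral.integral_const_mul, norm_mul, norm_of_nonneg hw, Real.norm_eq_abs,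
    intervalIntegral.integral_const_mul, intervalIntegral.integral_add
      ((hcont.const_mul 10).intervalIntegrable _ _) (by simp),
    intervalIntegral.integral_const_mul, intervalIntegral.integral_const, smul_eq_mul] at hle
  refine hle.trans ?_
  gcongr
  have h1 := integral_inv_one_add_mul_sq_le (a := a) (b := b) hm'
  have hpi := pi_lt_d2
  have h2 : (b - a) * (32 * ((A : ℝ) / m)) ≤ π * (32 * ((A : ℝ) / m)) := by
    gcongr; linarith
  have h3 : π / m ≤ 4 * (A / m) := by
    rw [mul_div_assoc']; gcongr; linarith
  have h4 : π * (32 * ((A : ℝ) / m)) ≤ 4 * (32 * ((A : ℝ) / m)) := by gcongr; linarith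
  have h5 : (0 : ℝ) ≤ A / m := by positivity
  rw [mul_div_assoc]
  linarith

/-- The Fourier integral that equals `subsetCount m A B` when `B = A (m + 1) / 2` is an integer. -/
def fourierCount (m A : ℕ) : ℝ := (∫ t in -(π / 2)..(π / 2), (centeredGen m A t).re) / π

theorem fourierCount_eq_subsetCount {m A B : ℕ} (h : 2 * B = A * (m + 1)) :
    fourierCount m A = subsetCount m A B := by
  have h1 := congrArg Complex.re (subsetCount_eq_integral h)
  have h2 : ∫ t in -(π / 2)..(π / 2), (centeredGen m A t).re =
      (∫ t in -(π / 2)..(π / 2), centeredGen m A t).re :=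
    Complex.reCLM.intervalIntegral_comp_comm
      ((continuous_centeredGen m A).intervalIntegrable (μ := volume) (-(π / 2)) (π / 2))
  rw [show (1 : ℂ) / π = ((1 / π : ℝ) : ℂ) by push_cast; rfl, Complex.re_ofReal_mul,
    Complex.natCast_re] at h1
  rw [fourierCount, h1, h2]
  ring

/-- The Fourier integral is concentrated on `|t| ≤ 2 / m`. -/
theorem setWeight_mul_abs_fourierCount_sub_le {m A : ℕ} (hA : 2 ≤ A) (hAm : 32 * A ≤ m) :
    setWeight m A * |π * fourierCount m A - centralIntegral m A / m| ≤
      (9 / 10) ^ A * (400 * A / m) := by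
  have hm' : (0 : ℝ) < m := by exact_mod_cast (by omega : 0 < m)
  have hw := setWeight_nonneg (m := m) (A := A) (by omega)
  have hcont : Continuous fun t => (centeredGen m A t).re :=
    Complex.continuous_re.comp (continuous_centeredGen m A)
  have hint : ∀ a b : ℝ, IntervalIntegrable (fun t => (centeredGen m A t).re) volume a b :=
    fun a b => hcont.intervalIntegrable a b
  have h2m : 2 / (m : ℝ) ≤ π / 2 := by
    rw [div_le_div_iff₀ hm' (by norm_num)]
    have : (64 : ℝ) ≤ m := by exact_mod_cast (by omega : 64 ≤ m)
    nlinarith [pi_gt_three]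
  have hc : centralIntegral m A / m = ∫ t in -(2 / m : ℝ)..(2 / m), (centeredGen m A t).re := by
    rw [centralIntegral, intervalIntegral.integral_comp_div (fun t => (centeredGen m A t).re) hm'.ne',
      smul_eq_mul, neg_div]
    field_simp
  have hsplit : π * fourierCount m A - centralIntegral m A / m =
      (∫ t in -(π / 2)..(-(2 / m)), (centeredGen m A t).re) +
        ∫ t in (2 / m : ℝ)..(π / 2), (centeredGen m A t).re := by
    rw [fourierCount, mul_div_cancel₀ _ pi_ne_zero, hc, ← intervalIntegral.integral_add_adjacent_intervals
      (hint _ (-(2 / m))) (hint _ _), ← intervalIntegral.integral_add_adjacent_intervals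
      (hint _ (2 / m)) (hint _ (π / 2))]
    ring
  have hpos : (0 : ℝ) < 2 / m := by positivity
  have h1 := setWeight_mul_abs_integral_le (a := -(π / 2)) (b := -(2 / m)) hA hAm (by linarith)
    le_rfl (by linarith) (fun t ht => by
      rw [abs_of_neg (by linarith [ht.2])]
      have : 2 / (m : ℝ) ≤ -t := by linarith [ht.2]
      rw [div_le_iff₀ hm'] at this
      linarith)
  have h2 := setWeight_mul_abs_integral_le (a := 2 / m) (b := π / 2) hA hAm (by linarith)
    (by linarith) le_rfl (fun t ht => by
      rw [abs_of_pos (by linarith [ht.1])]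
      have : 2 / (m : ℝ) ≤ t := ht.1.le
      rw [div_le_iff₀ hm'] at this
      linarith)
  rw [hsplit]
  have h3 := mul_le_mul_of_nonneg_left (abs_add_le
    (∫ t in -(π / 2)..(-(2 / m)), (centeredGen m A t).re)
    (∫ t in (2 / m : ℝ)..(π / 2), (centeredGen m A t).re)) hw
  have h4 : ((9 : ℝ) / 10) ^ A * (400 * A / m) = (9 / 10) ^ A * (200 * A / m) +
    (9 / 10) ^ A * (200 * A / m) := by ring
  linarith

/-! ### Stirling's formula with its first correction -/

/-- The relative error of Stirling's formula, on a logarithmic scale. -/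
def stirlingErr (n : ℕ) : ℝ := log n.factorial - (n * log n - n + log (2 * π * n) / 2)

theorem stirlingErr_eq {n : ℕ} (hn : n ≠ 0) :
    stirlingErr n = log (Stirling.stirlingSeq n) - log (√π) := by
  have hn' : (0 : ℝ) < n := by exact_mod_cast Nat.pos_of_ne_zero hn
  have hpi := pi_pos
  rw [Stirling.log_stirlingSeq_formula, stirlingErr, log_sqrt hpi.le,
    log_div hn'.ne' (exp_pos _).ne', log_exp, log_mul (by positivity) hn'.ne',
    log_mul (by norm_num) hpi.ne', log_mul (by norm_num) hn'.ne']
  ring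

theorem tendsto_stirlingErr : Tendsto stirlingErr atTop (𝓝 0) := by
  have h := (Stirling.tendsto_stirlingSeq_sqrt_pi.log (by positivity)).sub_const (log √π)
  rw [sub_self] at h
  refine h.congr' ?_
  filter_upwards [eventually_ne_atTop 0] with n hn
  exact (stirlingErr_eq hn).symm

/-- By Robbins' bound `stirlingErr n - 1 / (12 n)` is increasing. -/
theorem stirlingErr_sub_succ_le (n : ℕ) :
    stirlingErr (n + 1) - stirlingErr (n + 2) ≤ 1 / (12 * (n + 1)) - 1 / (12 * ((n : ℝ) + 2)) := by
  have h := Stirling.log_stirlingSeq_sdiff_le (n + 1)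
  rw [stirlingErr_eq (by omega), stirlingErr_eq (by omega)]
  have e : 1 / (12 * (n + 1)) - 1 / (12 * ((n : ℝ) + 2)) =
      1 / (12 * ((n + 1 : ℕ) : ℝ) * (((n + 1 : ℕ) : ℝ) + 1)) := by
    push_cast; field_simp; ring
  rw [e]
  linarith

/-- By the first term of the series for the increments, `stirlingErr n - 1 / (12 n) + 1 / n ^ 3` is
decreasing. -/
theorem le_stirlingErr_sub_succ (n : ℕ) :
    1 / (12 * ((n : ℝ) + 1)) - 1 / (12 * ((n : ℝ) + 2)) -
      (1 / ((n : ℝ) + 1) ^ 3 - 1 / ((n : ℝ) + 2) ^ 3) ≤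
      stirlingErr (n + 1) - stirlingErr (n + 2) := by
  have h := le_hasSum (Stirling.log_stirlingSeq_sdiff_hasSum n) 0 fun k _ => by positivity
  rw [stirlingErr_eq (by omega), stirlingErr_eq (by omega)]
  have key : 1 / (12 * ((n : ℝ) + 1)) - 1 / (12 * ((n : ℝ) + 2)) -
      (1 / ((n : ℝ) + 1) ^ 3 - 1 / ((n : ℝ) + 2) ^ 3) ≤
      1 / 3 * (1 / (2 * ((n : ℝ) + 1) + 1)) ^ 2 := by
    obtain ⟨p, hp⟩ : ∃ p : ℝ, p = (n + 1) * (n + 2) := ⟨_, rfl⟩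
    have hp0 : 1 ≤ p := by rw [hp]; nlinarith [n.cast_nonneg (α := ℝ)]
    have e1 : 1 / (12 * ((n : ℝ) + 1)) - 1 / (12 * ((n : ℝ) + 2)) = 1 / (12 * p) := by
      rw [hp]; field_simp; ring
    have e2 : 1 / ((n : ℝ) + 1) ^ 3 - 1 / ((n : ℝ) + 2) ^ 3 = (3 * p + 1) / p ^ 3 := by
      rw [hp]; field_simp; ring
    have e3 : 1 / 3 * (1 / (2 * ((n : ℝ) + 1) + 1)) ^ 2 = 1 / (12 * p + 3) := by
      have : 12 * p + 3 = 3 * (2 * ((n : ℝ) + 1) + 1) ^ 2 := by rw [hp]; ring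
      rw [this]; field_simp
    have e4 : 1 / (12 * p) - 1 / (12 * p + 3) ≤ (3 * p + 1) / p ^ 3 := by
      rw [div_sub_div _ _ (by positivity) (by positivity),
        div_le_div_iff₀ (by positivity) (by positivity)]
      nlinarith [pow_pos (by linarith : 0 < p) 3, pow_pos (by linarith : 0 < p) 2]
    rw [e1, e2, e3]
    linarith
  refine key.trans ?_
  norm_num at h ⊢
  linarith

theorem abs_stirlingErr_sub_le {n : ℕ} (hn : n ≠ 0) :
    |stirlingErr n - 1 / (12 * n)| ≤ 1 / (n : ℝ) ^ 3 := by
  obtain ⟨k, rfl⟩ := Nat.exists_eq_succ_of_ne_zero hn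
  have hinv : ∀ j : ℕ, j ≠ 0 → Tendsto (fun n : ℕ => 1 / ((n : ℝ) + 1) ^ j) atTop (𝓝 0) := by
    intro j hj
    have := (tendsto_one_div_add_atTop_nhds_zero_nat (𝕜 := ℝ)).pow j
    simpa [div_pow, hj] using this
  have h0 := (tendsto_add_atTop_iff_nat 1).2 tendsto_stirlingErr
  have h1 : Tendsto (fun n : ℕ => stirlingErr (n + 1) - 1 / (12 * ((n : ℝ) + 1))) atTop (𝓝 0) := by
    have := h0.sub ((hinv 1 one_ne_zero).const_mul (1 / 12))
    simp only [mul_zero, sub_zero] at this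
    refine this.congr fun n => ?_
    field_simp
  have hmono : Monotone fun n : ℕ => stirlingErr (n + 1) - 1 / (12 * ((n : ℝ) + 1)) := by
    refine monotone_nat_of_le_succ fun n => ?_
    have := stirlingErr_sub_succ_le n
    push_cast
    rw [show (n : ℝ) + 1 + 1 = n + 2 by ring]
    linarith
  have hanti : Antitone fun n : ℕ => stirlingErr (n + 1) - 1 / (12 * ((n : ℝ) + 1)) +
      1 / ((n : ℝ) + 1) ^ 3 := by
    refine antitone_nat_of_succ_le fun n => ?_
    have := le_stirlingErr_sub_succ n
    push_cast
    rw [show (n : ℝ) + 1 + 1 = n + 2 by ring]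
    linarith
  have h2 := h1.add (hinv 3 (by norm_num))
  rw [add_zero] at h2
  have u := hmono.ge_of_tendsto h1 k
  have l := hanti.le_of_tendsto h2 k
  push_cast
  rw [abs_le]
  have : (0 : ℝ) ≤ 1 / ((k : ℝ) + 1) ^ 3 := by positivity
  constructor <;> linarith

/-! ### Calculus of expansions to second order -/

/-- `a` is an infinitesimal along `l`, and `e` an error term at least as large as `a ^ 3`. -/
structure IsScale {ι : Type*} (l : Filter ι) (a e : ι → ℝ) : Prop where
  tendsto : Tendsto a l (𝓝 0)
  cube : (fun x => a x ^ 3) =O[l] e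
  err : e =O[l] a

/-- `f = 1 + p a + q a ^ 2 + O(e)` along `l`. -/
def HasExpansion {ι : Type*} (l : Filter ι) (a e f : ι → ℝ) (p q : ℝ) : Prop :=
  (fun x => f x - (1 + p * a x + q * a x ^ 2)) =O[l] e

namespace IsScale

variable {ι : Type*} {l : Filter ι} {a e f g : ι → ℝ} {p q p' q' : ℝ}

theorem isBigO_one (h : IsScale l a e) : a =O[l] fun _ => (1 : ℝ) := h.tendsto.isBigO_one ℝ

theorem err_isBigO_one (h : IsScale l a e) : e =O[l] fun _ => (1 : ℝ) := h.err.trans h.isBigO_one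

theorem pow_isBigO_one (h : IsScale l a e) (k : ℕ) :
    (fun x => a x ^ k) =O[l] fun _ => (1 : ℝ) := by
  simpa using h.isBigO_one.pow k

theorem sq_isBigO (h : IsScale l a e) : (fun x => a x ^ 2) =O[l] a := by
  simpa [sq] using h.isBigO_one.mul (isBigO_refl a l)

theorem four_isBigO (h : IsScale l a e) : (fun x => a x ^ 4) =O[l] e := by
  simpa [← pow_succ'] using h.isBigO_one.mul h.cube

theorem poly_isBigO_one (h : IsScale l a e) (p q : ℝ) :
    (fun x => 1 + p * a x + q * a x ^ 2) =O[l] fun _ => (1 : ℝ) :=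
  ((isBigO_refl _ _).add (h.isBigO_one.const_mul_left p)).add
    ((h.pow_isBigO_one 2).const_mul_left q)

theorem hasExpansion_isBigO_one (h : IsScale l a e) (hf : HasExpansion l a e f p q) :
    f =O[l] fun _ => (1 : ℝ) := by
  simpa using (hf.trans h.err_isBigO_one).add (h.poly_isBigO_one p q)

theorem hasExpansion_mul (h : IsScale l a e) (hf : HasExpansion l a e f p q)
    (hg : HasExpansion l a e g p' q') :
    HasExpansion l a e (fun x => f x * g x) (p + p') (q + q' + p * p') := by
  have h1 := hf.mul (h.hasExpansion_isBigO_one hg)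
  have h2 := (h.poly_isBigO_one p q).mul hg
  have h3 := (h.cube.const_mul_left (p * q' + q * p')).add (h.four_isBigO.const_mul_left (q * q'))
  simp only [mul_one, one_mul] at h1 h2
  refine ((h1.add h2).add h3).congr_left fun x => ?_
  ring

theorem hasExpansion_exp (h : IsScale l a e) (hf : (fun x => f x - (p * a x + q * a x ^ 2)) =O[l] e) :
    HasExpansion l a e (fun x => exp (f x)) p (q + p ^ 2 / 2) := by
  have hT : (fun x => p * a x + q * a x ^ 2) =O[l] a :=
    ((isBigO_refl a l).const_mul_left p).add (h.sq_isBigO.const_mul_left q)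
  have hfa : f =O[l] a := by simpa using (hf.trans h.err).add hT
  have hf0 : Tendsto f l (𝓝 0) := hfa.trans_tendsto h.tendsto
  have h1 : (fun x => exp (f x) - (1 + f x + f x ^ 2 / 2)) =O[l] e := by
    have := (Real.exp_sub_sum_range_isBigO_pow 3).comp_tendsto hf0
    refine ((this.trans (hfa.pow 3)).trans h.cube).congr_left fun x => ?_
    simp [Finset.sum_range_succ]
  have h2 := hf.mul ((hfa.add hT).trans h.isBigO_one)
  have h3 := (h.cube.const_mul_left (p * q)).add (h.four_isBigO.const_mul_left (q ^ 2 / 2))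
  simp only [mul_one] at h2
  refine (((h1.add hf).add (h2.const_mul_left (1 / 2))).add h3).congr_left fun x => ?_
  ring

end IsScale

/-! ### The expansion of the central probability -/

/-- Pairs `(m, A)` with `A → ∞` and `A / m → 0`. -/
def sparse : Filter (ℕ × ℕ) :=
  comap (fun x => x.2) atTop ⊓ comap (fun x => (x.2 : ℝ) / x.1) (𝓝[>] 0)

theorem tendsto_sparse {ι : Type*} {l : Filter ι} {m A : ι → ℕ} (hA : Tendsto A l atTop)
    (h : Tendsto (fun x => (A x : ℝ) / m x) l (𝓝 0)) (hm : ∀ᶠ x in l, 0 < m x) :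
    Tendsto (fun x => (m x, A x)) l sparse := by
  refine tendsto_inf.2 ⟨tendsto_comap_iff.2 hA, tendsto_comap_iff.2 ?_⟩
  refine tendsto_nhdsWithin_iff.2 ⟨h, ?_⟩
  filter_upwards [hm, hA.eventually_gt_atTop 0] with x hx hx'
  have h1 : (0 : ℝ) < m x := by exact_mod_cast hx
  have h2 : (0 : ℝ) < A x := by exact_mod_cast hx'
  exact div_pos h2 h1

theorem eventually_sparse (K : ℕ) : ∀ᶠ x in sparse, K ≤ x.2 ∧ K * x.2 ≤ x.1 := by
  have h1 : ∀ᶠ x in sparse, K ≤ x.2 :=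
    Eventually.filter_mono inf_le_left ((eventually_ge_atTop K).comap _)
  have h2 : ∀ᶠ x : ℕ × ℕ in sparse, (x.2 : ℝ) / x.1 ∈ Set.Ioo (0 : ℝ) (1 / (K + 1)) :=
    Eventually.filter_mono inf_le_right
      (Eventually.comap (Ioo_mem_nhdsGT (by positivity : (0 : ℝ) < 1 / (K + 1))) _)
  filter_upwards [h1, h2] with x hx1 hx2
  refine ⟨hx1, ?_⟩
  have hm : (0 : ℝ) < x.1 := by
    rcases Nat.eq_zero_or_pos x.1 with h0 | h0
    · have := hx2.1; simp [h0] at this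
    · exact_mod_cast h0
  have := hx2.2.le
  rw [div_le_div_iff₀ hm (by positivity)] at this
  have h3 : (K : ℝ) * x.2 ≤ x.1 := by
    have : (0 : ℝ) ≤ x.2 := x.2.cast_nonneg
    nlinarith
  exact_mod_cast h3

/-- The error term `1 / A ^ 3 + 1 / m`. -/
def sparseErr (x : ℕ × ℕ) : ℝ := 1 / (x.2 : ℝ) ^ 3 + 1 / x.1

theorem sparseErr_nonneg (x : ℕ × ℕ) : 0 ≤ sparseErr x := by rw [sparseErr]; positivity

theorem isScale_sparse : IsScale sparse (fun x => 1 / (x.2 : ℝ)) sparseErr where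
  tendsto := by
    have h : Tendsto (fun x : ℕ × ℕ => x.2) sparse atTop := tendsto_comap.mono_left inf_le_left
    exact tendsto_one_div_atTop_nhds_zero_nat.comp h
  cube := by
    refine IsBigO.of_bound 1 (Eventually.of_forall fun x => ?_)
    rw [norm_of_nonneg (by positivity), norm_of_nonneg (sparseErr_nonneg x), sparseErr, div_pow,
      one_pow, one_mul]
    have : (0 : ℝ) ≤ 1 / (x.1 : ℝ) := by positivity
    linarith
  err := by
    refine IsBigO.of_bound 2 ?_
    filter_upwards [eventually_sparse 1] with x hx
    have h1 : (1 : ℝ) ≤ x.2 := by exact_mod_cast hx.1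
    have h2 : (x.2 : ℝ) ≤ x.1 := by exact_mod_cast (one_mul x.2 ▸ hx.2)
    rw [norm_of_nonneg (sparseErr_nonneg x), norm_of_nonneg (by positivity), sparseErr, two_mul]
    gcongr
    exact le_self_pow₀ h1 (by norm_num)

theorem one_div_fst_isBigO : (fun x : ℕ × ℕ => 1 / (x.1 : ℝ)) =O[sparse] sparseErr := by
  refine IsBigO.of_bound 1 (Eventually.of_forall fun x => ?_)
  rw [norm_of_nonneg (by positivity), norm_of_nonneg (sparseErr_nonneg x), sparseErr, one_mul]
  have : (0 : ℝ) ≤ 1 / (x.2 : ℝ) ^ 3 := by positivity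
  linarith

theorem hasExpansion_sqrt :
    HasExpansion sparse (fun x => 1 / (x.2 : ℝ)) sparseErr (fun x => √(1 - 1 / (x.1 : ℝ))) 0 0 := by
  refine (IsBigO.of_bound 1 ?_).trans one_div_fst_isBigO
  filter_upwards [eventually_sparse 1] with x hx
  have h1 : (1 : ℝ) ≤ x.1 := by exact_mod_cast (by omega : 1 ≤ x.1)
  have h2 : 0 ≤ 1 / (x.1 : ℝ) := by positivity
  have h3 : 1 / (x.1 : ℝ) ≤ 1 := by rw [div_le_one (by linarith)]; exact h1
  rw [Real.norm_eq_abs, norm_of_nonneg h2, abs_le]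
  have h4 : √(1 - 1 / (x.1 : ℝ)) ≤ 1 := sqrt_le_one.2 (by linarith)
  have h5 : 1 - 1 / (x.1 : ℝ) ≤ √(1 - 1 / (x.1 : ℝ)) := by
    refine le_sqrt_of_sq_le ?_
    nlinarith
  constructor <;> linarith

theorem abs_stirlingErr_le {n : ℕ} (hn : n ≠ 0) : |stirlingErr n| ≤ 2 * (1 / (n : ℝ)) := by
  have h := abs_le.1 (abs_stirlingErr_sub_le hn)
  have h1 : (1 : ℝ) ≤ n := by exact_mod_cast Nat.one_le_iff_ne_zero.2 hn
  have h2 : 1 / (n : ℝ) ^ 3 ≤ 1 / n := by gcongr; exact le_self_pow₀ h1 (by norm_num)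
  have h3 : 1 / (12 * (n : ℝ)) = 1 / 12 * (1 / n) := by field_simp
  have h4 : 0 ≤ 1 / (n : ℝ) := by positivity
  rw [abs_le]
  constructor <;> linarith [h.1, h.2]

theorem hasExpansion_stirling :
    HasExpansion sparse (fun x => 1 / (x.2 : ℝ)) sparseErr
      (fun x => exp (stirlingErr x.1 - stirlingErr x.2 - stirlingErr (x.1 - x.2)))
      (-(1 / 12)) (0 + (-(1 / 12)) ^ 2 / 2) := by
  refine isScale_sparse.hasExpansion_exp (IsBigO.of_bound 6 ?_)
  filter_upwards [eventually_sparse 2] with x hx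
  have hm : (0 : ℝ) < x.1 := by exact_mod_cast (by omega : 0 < x.1)
  have hnm : (x.1 : ℝ) / 2 ≤ ((x.1 - x.2 : ℕ) : ℝ) := by
    have : (x.1 : ℝ) ≤ ((2 * (x.1 - x.2) : ℕ) : ℝ) := by
      exact_mod_cast (by omega : x.1 ≤ 2 * (x.1 - x.2))
    push_cast at this
    linarith
  have h1 := abs_le.1 (abs_stirlingErr_le (n := x.1) (by omega))
  have h2 := abs_le.1 (abs_stirlingErr_sub_le (n := x.2) (by omega))
  have h3 := abs_le.1 (abs_stirlingErr_le (n := x.1 - x.2) (by omega))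
  have h4 : 1 / ((x.1 - x.2 : ℕ) : ℝ) ≤ 2 * (1 / (x.1 : ℝ)) := by
    calc 1 / ((x.1 - x.2 : ℕ) : ℝ) ≤ 1 / ((x.1 : ℝ) / 2) := by gcongr
      _ = 2 * (1 / (x.1 : ℝ)) := by field_simp
  have h5 : 1 / (12 * (x.2 : ℝ)) = 1 / 12 * (1 / x.2) := by field_simp
  have h6 : (0 : ℝ) ≤ 1 / (x.2 : ℝ) ^ 3 := by positivity
  rw [norm_of_nonneg (sparseErr_nonneg x), Real.norm_eq_abs, sparseErr, abs_le]
  constructor <;> linarith [h1.1, h1.2, h2.1, h2.2, h3.1, h3.2]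

/-- The ratio of `A / 6` to the Gaussian rate is `1 + O(A / m)`. -/
theorem rate_ratio_sub_one_isBigO :
    (fun x : ℕ × ℕ => (x.2 : ℝ) / 6 / gaussRate x.1 x.2 - 1) =O[sparse]
      fun x => (x.2 : ℝ) / x.1 := by
  refine IsBigO.of_bound 6 ?_
  filter_upwards [eventually_sparse 2] with x hx
  have hm : (0 : ℝ) < x.1 := by exact_mod_cast (by omega : 0 < x.1)
  have hA : (1 : ℝ) ≤ x.2 := by exact_mod_cast (by omega : 1 ≤ x.2)
  have hAm : 2 * (x.2 : ℝ) ≤ x.1 := by exact_mod_cast hx.2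
  obtain ⟨A, hAd⟩ : ∃ A : ℝ, A = x.2 := ⟨_, rfl⟩
  obtain ⟨m, hmd⟩ : ∃ m : ℝ, m = x.1 := ⟨_, rfl⟩
  rw [gaussRate, ← hAd, ← hmd]
  rw [← hAd, ← hmd] at hAm
  rw [← hAd] at hA
  rw [← hmd] at hm
  have hmA : m - A ≠ 0 := by linarith
  have hmA' : 0 < m - A := by linarith
  have e : A / 6 / (A * (m - A) * (m + 1) / (6 * m ^ 2)) - 1 =
      (A * (m + 1) - m) / ((m - A) * (m + 1)) := by
    have : m + 1 ≠ 0 := by linarith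
    field_simp
    ring
  rw [e, norm_div, norm_of_nonneg (by positivity : 0 ≤ A / m), Real.norm_eq_abs, Real.norm_eq_abs,
    abs_of_nonneg (by nlinarith : 0 ≤ A * (m + 1) - m),
    abs_of_pos (by positivity : 0 < (m - A) * (m + 1)), mul_div_assoc',
    div_le_div_iff₀ (by positivity) hm]
  have h1 : m / 2 * (m + 1) ≤ (m - A) * (m + 1) := by gcongr; linarith
  have h2 : A * (m / 2 * (m + 1)) ≤ A * ((m - A) * (m + 1)) := by gcongr
  nlinarith

/-- The numbers are the Gaussian means of the Edgeworth polynomial at rate `A / 6`: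
`3 / 20` from `u ^ 4`, and `-1 / 7 + 21 / 160 = -13 / 1120` from `u ^ 6` and `u ^ 8`. -/
theorem hasExpansion_central :
    HasExpansion sparse (fun x => 1 / (x.2 : ℝ)) sparseErr
      (fun x => √(gaussRate x.1 x.2) / √π * (centralIntegral x.1 x.2 / x.1.choose x.2))
      (-(3 / 20)) (-(13 / 1120)) := by
  obtain ⟨C, hC, h⟩ := abs_centralIntegral_sub_le
  have h1 : (fun x : ℕ × ℕ =>
      √(gaussRate x.1 x.2) / √π * (centralIntegral x.1 x.2 / x.1.choose x.2) -
      (1 - x.2 / 180 * (3 / (2 * gaussRate x.1 x.2) ^ 2) -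
        x.2 / 2835 * (15 / (2 * gaussRate x.1 x.2) ^ 3) +
        x.2 ^ 2 / 64800 * (105 / (2 * gaussRate x.1 x.2) ^ 4))) =O[sparse] sparseErr := by
    refine IsBigO.of_bound C ?_
    filter_upwards [eventually_sparse 2] with x hx
    rw [norm_of_nonneg (sparseErr_nonneg x), Real.norm_eq_abs]
    exact h x.1 x.2 (by omega) hx.2
  let y : ℕ × ℕ → ℝ := fun x => (x.2 : ℝ) / 6 / gaussRate x.1 x.2
  have hb1 : (fun x : ℕ × ℕ => (x.2 : ℝ) / x.1) =O[sparse] fun _ => (1 : ℝ) :=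
    ((tendsto_comap.mono_left inf_le_right).mono_right nhdsWithin_le_nhds).isBigO_one ℝ
  have hy1 : y =O[sparse] fun _ => (1 : ℝ) := by
    have := (rate_ratio_sub_one_isBigO.trans hb1).add (isBigO_refl (fun _ => (1 : ℝ)) sparse)
    simpa [y] using this
  have ha : (fun x : ℕ × ℕ => (x.2 : ℝ) / x.1 * (1 / (x.2 : ℝ))) =O[sparse] sparseErr := by
    refine one_div_fst_isBigO.congr' ?_ EventuallyEq.rfl
    filter_upwards [eventually_sparse 1] with x hx
    have : (x.2 : ℝ) ≠ 0 := by exact_mod_cast (by omega : x.2 ≠ 0)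
    field_simp
  -- every power of the ratio may be replaced by one
  have hpow : ∀ k : ℕ, (fun x => (y x ^ k - 1) * (1 / (x.2 : ℝ))) =O[sparse] sparseErr := by
    intro k
    have hk : (fun x => y x ^ k - 1) =O[sparse] fun x : ℕ × ℕ => (x.2 : ℝ) / x.1 := by
      induction k with
      | zero => simpa using isBigO_zero _ _
      | succ k ih =>
        have h0 := ih.mul hy1
        simp only [mul_one] at h0
        refine (h0.add rate_ratio_sub_one_isBigO).congr_left fun x => ?_
        simp only [y]
        ring
    exact (hk.mul (isBigO_refl _ _)).trans ha
  have hpow' : ∀ k : ℕ, (fun x => (y x ^ k - 1) * (1 / (x.2 : ℝ)) ^ 2) =O[sparse] sparseErr := by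
    intro k
    have := (hpow k).mul isScale_sparse.isBigO_one
    simp only [mul_one] at this
    exact this.congr_left fun x => by ring
  refine (((h1.sub ((hpow 2).const_mul_left (3 / 20))).sub ((hpow' 3).const_mul_left (1 / 7))).add
    ((hpow' 4).const_mul_left (21 / 160))).congr' ?_ EventuallyEq.rfl
  filter_upwards [eventually_sparse 2] with x hx
  have hA : (0 : ℝ) < x.2 := by exact_mod_cast (by omega : 0 < x.2)
  have hg : 0 < gaussRate x.1 x.2 :=
    lt_of_lt_of_le (by positivity) (le_gaussRate (by omega : 0 < x.1) hx.2)
  simp only [y]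
  field_simp
  ring

/-- Stirling's formula for the probability that exactly the mean number of elements is selected. -/
theorem setWeight_mul_choose {m A : ℕ} (hA : 0 < A) (hAm : A < m) :
    setWeight m A * m.choose A =
      exp (stirlingErr m - stirlingErr A - stirlingErr (m - A)) * √(m / (2 * π * A * (m - A))) := by
  have hA' : (0 : ℝ) < A := by exact_mod_cast hA
  have hm' : (0 : ℝ) < m := by exact_mod_cast hA.trans hAm
  have hn' : (0 : ℝ) < (m : ℝ) - A := by
    have : (A : ℝ) < m := by exact_mod_cast hAm
    linarith
  have hpi := pi_pos
  have hcast : ((m - A : ℕ) : ℝ) = (m : ℝ) - A := Nat.cast_sub hAm.le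
  have hb : 0 < 1 - (A : ℝ) / m := by
    rw [sub_pos, div_lt_one hm']; linarith
  have hfac : ∀ k : ℕ, (0 : ℝ) < k.factorial := fun k => by exact_mod_cast k.factorial_pos
  have hch : (m.choose A : ℝ) = m.factorial / (A.factorial * (m - A).factorial) :=
    Nat.cast_choose ℝ hAm.le
  have hs : (0 : ℝ) < m / (2 * π * A * (m - A)) := by positivity
  have hw : 0 < setWeight m A := by rw [setWeight]; positivity
  have hc : (0 : ℝ) < m.choose A := by exact_mod_cast Nat.choose_pos hAm.le
  rw [← exp_log (mul_pos hw hc), ← exp_log (sqrt_pos.2 hs), ← exp_add]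
  congr 1
  have f1 := hfac A
  have f2 := hfac (m - A)
  have f3 := hfac m
  rw [log_mul hw.ne' hc.ne', hch, log_div f3.ne' (by positivity), log_mul f1.ne' f2.ne', setWeight,
    log_mul (by positivity) (by positivity), log_pow, log_pow, log_div hA'.ne' hm'.ne',
    show 1 - (A : ℝ) / m = (m - A) / m by field_simp, log_div hn'.ne' hm'.ne',
    log_sqrt hs.le, log_div hm'.ne' (by positivity), log_mul (by positivity) hn'.ne',
    log_mul (by positivity) hA'.ne', log_mul (by norm_num) hpi.ne', stirlingErr, stirlingErr,
    stirlingErr, hcast, log_mul (by positivity) hm'.ne', log_mul (by positivity) hA'.ne',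
    log_mul (by positivity) hn'.ne', log_mul (by norm_num) hpi.ne']
  ring

theorem gaussianCentralProb_pos {m A : ℕ} (hA : 0 < A) (hAm : A < m) :
    0 < gaussianCentralProb m (A / m) := by
  have hA' : (0 : ℝ) < A := by exact_mod_cast hA
  have hm' : (1 : ℝ) < m := by exact_mod_cast (by omega : 1 < m)
  have hb : 0 < 1 - (A : ℝ) / m := by
    rw [sub_pos, div_lt_one (by linarith)]; exact_mod_cast hAm
  have hsq : (0 : ℝ) < (m : ℝ) ^ 2 - 1 := by nlinarith
  have hpi := pi_pos
  rw [gaussianCentralProb]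
  positivity

/-- The exact factorisation behind the expansion: a boundary factor, the Stirling correction of the
number of elements, and the correction of their total. -/
theorem setWeight_mul_centralIntegral_div {m A : ℕ} (hA : 0 < A) (hAm : A < m) :
    setWeight m A * (centralIntegral m A / m / π) / gaussianCentralProb m (A / m) =
      √(1 - 1 / (m : ℝ)) * exp (stirlingErr m - stirlingErr A - stirlingErr (m - A)) *
        (√(gaussRate m A) / √π * (centralIntegral m A / m.choose A)) := by
  have hA' : (0 : ℝ) < A := by exact_mod_cast hA
  have hm' : (1 : ℝ) < m := by exact_mod_cast (by omega : 1 < m)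
  have hm0 : (0 : ℝ) < m := by linarith
  have hn' : (0 : ℝ) < (m : ℝ) - A := by
    have : (A : ℝ) < m := by exact_mod_cast hAm
    linarith
  have hpi := pi_pos
  have hc : (0 : ℝ) < m.choose A := by exact_mod_cast Nat.choose_pos hAm.le
  have hP := gaussianCentralProb_pos hA hAm
  have hsw := setWeight_mul_choose hA hAm
  have hw : setWeight m A = exp (stirlingErr m - stirlingErr A - stirlingErr (m - A)) *
      √(m / (2 * π * A * (m - A))) / m.choose A := by
    rw [eq_div_iff hc.ne', hsw]
  have hsq : (0 : ℝ) < (m : ℝ) ^ 2 - 1 := by nlinarith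
  have key : √((m : ℝ) / (2 * π * A * (m - A))) =
      √(1 - 1 / (m : ℝ)) * (√(gaussRate m A) / √π) * (m * π * gaussianCentralProb m (A / m)) := by
    have hm1 : 0 ≤ 1 - 1 / (m : ℝ) := by
      rw [sub_nonneg, div_le_one hm0]; exact hm'.le
    have hg : 0 ≤ gaussRate m A := by rw [gaussRate]; positivity
    rw [← sqrt_div hg, ← sqrt_mul hm1, ← sqrt_sq (by positivity :
      0 ≤ (m : ℝ) * π * gaussianCentralProb m (A / m)), ← sqrt_mul (by positivity)]
    congr 1
    rw [gaussianCentralProb, mul_pow, mul_pow (1 / _), sq_sqrt (by positivity), gaussRate]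
    have : (m : ℝ) ^ 2 - 1 = (m - 1) * (m + 1) := by ring
    rw [this]
    have h1 : (m : ℝ) - 1 ≠ 0 := by linarith
    have h2 : (m : ℝ) - A ≠ 0 := hn'.ne'
    have h3 : 1 - (A : ℝ) / m = (m - A) / m := by field_simp
    rw [h3]
    field_simp
    norm_num
  rw [hw, key]
  field_simp

/-- The tail of the Fourier integral is exponentially small in `A`, relative to the main term. -/
theorem tail_isBigO :
    (fun x : ℕ × ℕ => setWeight x.1 x.2 *
      (fourierCount x.1 x.2 - centralIntegral x.1 x.2 / x.1 / π) /
        gaussianCentralProb x.1 (x.2 / x.1)) =O[sparse] sparseErr := by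
  have h1 : (fun x : ℕ × ℕ => setWeight x.1 x.2 *
      (fourierCount x.1 x.2 - centralIntegral x.1 x.2 / x.1 / π) /
        gaussianCentralProb x.1 (x.2 / x.1)) =O[sparse]
      fun x => (x.2 : ℝ) ^ 2 * (9 / 10) ^ x.2 := by
    refine IsBigO.of_bound 400 ?_
    filter_upwards [eventually_sparse 32] with x hx
    have hP := gaussianCentralProb_pos (m := x.1) (A := x.2) (by omega) (by omega)
    have hpi := pi_pos
    have hA' : (0 : ℝ) < x.2 := by exact_mod_cast (by omega : 0 < x.2)
    have hm0 : (1 : ℝ) < x.1 := by exact_mod_cast (by omega : 1 < x.1)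
    have hb : (x.2 : ℝ) / x.1 < 1 := by
      rw [div_lt_one (by linarith)]; exact_mod_cast (by omega : x.2 < x.1)
    have ht := setWeight_mul_abs_fourierCount_sub_le (m := x.1) (A := x.2) (by omega) hx.2
    have hw := setWeight_nonneg (m := x.1) (A := x.2) (by omega)
    have e : fourierCount x.1 x.2 - centralIntegral x.1 x.2 / x.1 / π =
        (π * fourierCount x.1 x.2 - centralIntegral x.1 x.2 / x.1) / π := by field_simp
    rw [norm_div, norm_mul, norm_of_nonneg hw, norm_of_nonneg hP.le, e, norm_div,
      norm_of_nonneg hpi.le,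
      norm_of_nonneg (by positivity : (0 : ℝ) ≤ (x.2 : ℝ) ^ 2 * (9 / 10) ^ x.2), div_le_iff₀ hP, mul_div_assoc',
      div_le_iff₀ hpi, Real.norm_eq_abs]
    refine ht.trans ?_
    -- the Gaussian approximation is of order at least `1 / (A m)`
    have hlow : 1 ≤ x.2 * x.1 * (gaussianCentralProb x.1 (x.2 / x.1) * π) := by
      have hsq : (0 : ℝ) < (x.1 : ℝ) ^ 2 - 1 := by nlinarith
      have hs : 1 / (x.1 : ℝ) ≤ √(3 / ((x.1 : ℝ) ^ 2 - 1)) := by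
        refine le_sqrt_of_sq_le ?_
        rw [div_pow, one_pow, div_le_div_iff₀ (by positivity) hsq]
        nlinarith
      have e2 : x.2 * x.1 * (gaussianCentralProb x.1 (x.2 / x.1) * π) =
          x.1 * √(3 / ((x.1 : ℝ) ^ 2 - 1)) / (1 - (x.2 : ℝ) / x.1) := by
        rw [gaussianCentralProb]
        have : 1 - (x.2 : ℝ) / x.1 ≠ 0 := by linarith
        have h0 : (x.1 : ℝ) ≠ 0 := by linarith
        field_simp
      rw [e2, le_div_iff₀ (by linarith)]
      have h3 : 1 ≤ x.1 * √(3 / ((x.1 : ℝ) ^ 2 - 1)) := by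
        have := mul_le_mul_of_nonneg_left hs (by linarith : (0 : ℝ) ≤ x.1)
        rwa [mul_one_div_cancel (by linarith)] at this
      have h4 : 0 ≤ (x.2 : ℝ) / x.1 := by positivity
      linarith
    have h5 : (0 : ℝ) ≤ (9 / 10) ^ x.2 * (400 * x.2 / x.1) := by positivity
    calc (9 / 10 : ℝ) ^ x.2 * (400 * x.2 / x.1) ≤ (9 / 10 : ℝ) ^ x.2 * (400 * x.2 / x.1) *
          (x.2 * x.1 * (gaussianCentralProb x.1 (x.2 / x.1) * π)) := le_mul_of_one_le_right h5 hlow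
      _ = _ := by field_simp
  refine h1.trans (IsBigO.trans ?_ isScale_sparse.cube)
  have h : Tendsto (fun x : ℕ × ℕ => x.2) sparse atTop := tendsto_comap.mono_left inf_le_left
  have h2 := (tendsto_pow_const_mul_const_pow_of_abs_lt_one 5
    (by norm_num [abs_of_pos] : |(9 / 10 : ℝ)| < 1)).comp h
  have h3 := (h2.isBigO_one ℝ).mul
    (isBigO_refl (fun x : ℕ × ℕ => (1 / (x.2 : ℝ)) ^ 3) sparse)
  simp only [one_mul] at h3
  refine h3.congr' ?_ EventuallyEq.rfl
  filter_upwards [eventually_sparse 1] with x hx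
  have : (x.2 : ℝ) ≠ 0 := by exact_mod_cast (by omega : x.2 ≠ 0)
  simp only [Function.comp]
  field_simp

/-- The Edgeworth expansion of the ratio of the central probability to its Gaussian
approximation. -/
theorem hasExpansion_ratio :
    HasExpansion sparse (fun x => 1 / (x.2 : ℝ)) sparseErr
      (fun x => setWeight x.1 x.2 * fourierCount x.1 x.2 / gaussianCentralProb x.1 (x.2 / x.1))
      (-(7 / 30)) (11 / 2520) := by
  have h := isScale_sparse.hasExpansion_mul
    (isScale_sparse.hasExpansion_mul hasExpansion_sqrt hasExpansion_stirling) hasExpansion_central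
  refine (h.add tail_isBigO).congr' ?_ EventuallyEq.rfl
  filter_upwards [eventually_sparse 2] with x hx
  rw [← setWeight_mul_centralIntegral_div (by omega) (by omega)]
  ring

/-! ### Central probabilities and magic series -/

/-- With integral means, the central probability is a weighted number of subsets. -/
theorem centralProb_eq {m A B : ℕ} {β : ℝ} (hm : 0 < m) (hA : β * m = A)
    (hB : β * m * (m + 1) / 2 = B) :
    centralProb m β = setWeight m A * fourierCount m A := by
  have hm' : (m : ℝ) ≠ 0 := by exact_mod_cast hm.ne'
  have hβ : β = A / m := by rw [← hA]; field_simp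
  have h2 : 2 * B = A * (m + 1) := by
    have : (2 * B : ℝ) = A * (m + 1) := by rw [← hB, ← hA]; ring
    exact_mod_cast this
  have hset : (Finset.Icc 1 m).powerset.filter
      (fun S : Finset ℕ => (S.card : ℝ) = A ∧ ∑ i ∈ S, (i : ℝ) = B) =
      ((Finset.Icc 1 m).powersetCard A).filter (fun S => ∑ i ∈ S, i = B) := by
    ext S
    simp only [Finset.mem_filter, Finset.mem_powerset, Finset.mem_powersetCard, and_assoc, Nat.cast_inj]
    rw [show ∑ i ∈ S, (i : ℝ) = ((∑ i ∈ S, i : ℕ) : ℝ) by rw [Nat.cast_sum], Nat.cast_inj]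
  rw [centralProb, selectionProb, hA, show (A : ℝ) * (m + 1) / 2 = B by rw [← hB, hA], hset,
    fourierCount_eq_subsetCount h2, subsetCount, setWeight, hβ]
  rw [Finset.sum_congr rfl (g := fun _ => ((A : ℝ) / m) ^ A * (1 - (A : ℝ) / m) ^ (m - A))]
  · rw [Finset.sum_const, nsmul_eq_mul, mul_comm]
  · intro S hS
    rw [(Finset.mem_powersetCard.1 (Finset.mem_filter.1 hS).1).2]

theorem centralProb_isLittleO (m : ℕ → ℕ) (β : ℕ → ℝ) (hβ : Tendsto β atTop (𝓝 0))
    (hm : Tendsto (fun k => β k * (m k : ℝ)) atTop atTop)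
    (hint : ∀ k, ∃ A B : ℕ,
      β k * (m k : ℝ) = A ∧ β k * (m k : ℝ) * ((m k : ℝ) + 1) / 2 = B) :
    (fun k => centralProb (m k) (β k) / gaussianCentralProb (m k) (β k)
        - (1 + K₁ / (β k * (m k : ℝ))))
      =o[atTop] fun k => 1 / (β k * (m k : ℝ)) := by
  choose A B hA hB using hint
  have hmpos : ∀ᶠ k in atTop, 0 < m k := by
    filter_upwards [hm.eventually_gt_atTop 0] with k hk
    rcases Nat.eq_zero_or_pos (m k) with h0 | h0
    · simp [h0] at hk
    · exact h0
  have hβeq : ∀ᶠ k in atTop, β k = (A k : ℝ) / m k := by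
    filter_upwards [hmpos] with k hk
    have hk' : (m k : ℝ) ≠ 0 := by exact_mod_cast hk.ne'
    rw [← hA k]; field_simp
  have hAtop : Tendsto A atTop atTop := by
    simp_rw [hA] at hm
    exact tendsto_natCast_atTop_iff.1 hm
  have hAm : Tendsto (fun k => (A k : ℝ) / m k) atTop (𝓝 0) := hβ.congr' hβeq
  have hlim := tendsto_sparse hAtop hAm hmpos
  have h1 := hasExpansion_ratio.comp_tendsto hlim
  simp_rw [hA]
  have ha : Tendsto (fun k => 1 / (A k : ℝ)) atTop (𝓝 0) :=
    tendsto_one_div_atTop_nhds_zero_nat.comp hAtop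
  have hsq : (fun k => (1 / (A k : ℝ)) ^ 2) =o[atTop] fun k => 1 / (A k : ℝ) := by
    have := ((isLittleO_one_iff ℝ).2 ha).mul_isBigO (isBigO_refl (fun k => 1 / (A k : ℝ)) atTop)
    simp only [one_mul] at this
    exact this.congr_left fun k => (sq _).symm
  have herr : (fun k => sparseErr (m k, A k)) =o[atTop] fun k => 1 / (A k : ℝ) := by
    have h3 := hsq.mul_isBigO (ha.isBigO_one ℝ)
    have h4 := ((isLittleO_one_iff ℝ).2 hAm).mul_isBigO
      (isBigO_refl (fun k => 1 / (A k : ℝ)) atTop)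
    simp only [one_mul, mul_one] at h3 h4
    refine (h3.add h4).congr' ?_ EventuallyEq.rfl
    filter_upwards [hmpos, hAtop.eventually_gt_atTop 0] with k hk hk'
    have h5 : (m k : ℝ) ≠ 0 := by exact_mod_cast hk.ne'
    have h6 : (A k : ℝ) ≠ 0 := by exact_mod_cast hk'.ne'
    simp only [sparseErr]
    field_simp
  refine ((h1.trans_isLittleO herr).add (hsq.const_mul_left (11 / 2520))).congr' ?_ EventuallyEq.rfl
  filter_upwards [hmpos, hβeq] with k hk hk'
  rw [centralProb_eq hk (hA k) (hB k), K₁_eq, hk']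
  simp only [Function.comp]
  ring

theorem natCast_pow_eq_mul {α N : ℕ} (hα : 1 ≤ α) :
    (N : ℝ) ^ α = N ^ (α - 1) * N := by
  rw [← pow_succ, Nat.sub_add_cancel hα]

theorem tendsto_hypercube {α : ℕ} (hα : 2 ≤ α) :
    Tendsto (fun N : ℕ => (N ^ α, N)) atTop sparse := by
  refine tendsto_sparse tendsto_id ?_ ?_
  · have h := (tendsto_one_div_atTop_nhds_zero_nat (𝕜 := ℝ)).pow (α - 1)
    rw [zero_pow (by omega)] at h
    refine h.congr' ?_
    filter_upwards [eventually_gt_atTop 0] with N hN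
    have : (N : ℝ) ≠ 0 := by exact_mod_cast hN.ne'
    push_cast
    rw [natCast_pow_eq_mul (by omega : 1 ≤ α), div_pow, one_pow]
    field_simp
  · filter_upwards [eventually_gt_atTop 0] with N hN
    positivity

theorem gaussianCount_eq {α N : ℕ} (hα : 2 ≤ α) (hN : 2 ≤ N) :
    gaussianCount α N = gaussianCentralProb (N ^ α) (N / (N ^ α : ℕ)) / setWeight (N ^ α) N := by
  have hN' : (0 : ℝ) < N := by exact_mod_cast (by omega : 0 < N)
  have hle : N ≤ N ^ α := Nat.le_self_pow (by omega) N
  have hβ : 1 / (N : ℝ) ^ (α - 1) = N / (N ^ α : ℕ) := by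
    push_cast
    rw [natCast_pow_eq_mul (by omega : 1 ≤ α)]
    field_simp
  have hb : (N : ℝ) / (N ^ α : ℕ) < 1 := by
    rw [div_lt_one (by positivity)]
    exact_mod_cast lt_self_pow₀ (by omega : 1 < N) (by omega : 1 < α)
  have hb0 : 0 < (N : ℝ) / (N ^ α : ℕ) := by positivity
  have e1 : (N : ℝ) / (N ^ α : ℕ) * (N : ℝ) ^ α = (N : ℕ) := by
    push_cast; field_simp
  have e2 : (1 - (N : ℝ) / (N ^ α : ℕ)) * (N : ℝ) ^ α = ((N ^ α - N : ℕ) : ℝ) := by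
    rw [sub_mul, e1, Nat.cast_sub hle]; push_cast; ring
  rw [gaussianCount]
  simp only [hβ]
  rw [e1, e2, rpow_neg hb0.le, rpow_neg (by linarith), rpow_natCast, rpow_natCast, setWeight]
  ring

theorem magicSeriesCount_div_gaussianCount {α N : ℕ} (hα : 2 ≤ α) (hN : 2 ≤ N) :
    (magicSeriesCount α N : ℝ) / gaussianCount α N =
      setWeight (N ^ α) N * fourierCount (N ^ α) N /
        gaussianCentralProb (N ^ α) (N / (N ^ α : ℕ)) := by
  have h2 := two_mul_magicSum (α := α) (N := N) (by omega) (by omega)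
  rw [gaussianCount_eq hα hN, fourierCount_eq_subsetCount h2, magicSeriesCount, div_div_eq_mul_div]
  ring

theorem sparseErr_hypercube_isBigO {α k : ℕ} (hk : k ≤ α) (hk3 : k ≤ 3) :
    (fun N : ℕ => sparseErr (N ^ α, N)) =O[atTop] fun N : ℕ => 1 / (N : ℝ) ^ k := by
  refine IsBigO.of_bound 2 ?_
  filter_upwards [eventually_gt_atTop 0] with N hN
  have h1 : (1 : ℝ) ≤ N := by exact_mod_cast hN
  have h2 : 1 / (N : ℝ) ^ 3 ≤ 1 / (N : ℝ) ^ k := by gcongr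
  have h3 : 1 / (N : ℝ) ^ α ≤ 1 / (N : ℝ) ^ k := by gcongr
  rw [norm_of_nonneg (sparseErr_nonneg _), norm_of_nonneg (by positivity), sparseErr]
  push_cast
  linarith

theorem isScale_nat : IsScale atTop (fun N : ℕ => 1 / (N : ℝ)) (fun N : ℕ => 1 / (N : ℝ) ^ 3) where
  tendsto := tendsto_one_div_atTop_nhds_zero_nat
  cube := (isBigO_refl _ _).congr_left fun N => by rw [div_pow, one_pow]
  err := by
    refine IsBigO.of_bound 1 ?_
    filter_upwards [eventually_gt_atTop 0] with N hN
    have h1 : (1 : ℝ) ≤ N := by exact_mod_cast hN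
    rw [norm_of_nonneg (by positivity), norm_of_nonneg (by positivity), one_mul]
    gcongr
    exact le_self_pow₀ h1 (by norm_num)

/-- The logarithm of the ratio of `gaussianCount α N` to its elementary approximation. -/
def gaussianCountLog (α N : ℕ) : ℝ :=
  -((N : ℝ) ^ α - N + 1) * log (1 - 1 / (N : ℝ) ^ (α - 1)) - N - log (1 - (1 / (N : ℝ) ^ α) ^ 2) / 2

theorem gaussianCount_div {α N : ℕ} (hα : 2 ≤ α) (hN : 2 ≤ N) :
    gaussianCount α N / (√3 / π * ((N : ℝ) ^ (α - 1) * exp 1) ^ N / (N : ℝ) ^ (α + 1)) =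
      exp (gaussianCountLog α N) := by
  have hN1 : (1 : ℝ) < N := by exact_mod_cast (by omega : 1 < N)
  have hN0 : (0 : ℝ) < N := by linarith
  have hpi := pi_pos
  obtain ⟨P, hP⟩ : ∃ P : ℝ, P = (N : ℝ) ^ (α - 1) := ⟨_, rfl⟩
  have hP1 : 1 < P := by rw [hP]; exact one_lt_pow₀ hN1 (by omega)
  have hm : (N : ℝ) ^ α = P * N := by rw [hP]; exact natCast_pow_eq_mul (by omega)
  have hm1 : 1 < P * N := by nlinarith
  have hb : 0 < 1 - 1 / P := by rw [sub_pos, div_lt_one (by linarith)]; exact hP1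
  have hb2 : 0 < 1 - (1 / (P * N)) ^ 2 := by
    rw [sub_pos, div_pow, one_pow, div_lt_one (by positivity)]
    exact one_lt_pow₀ hm1 (by norm_num)
  rw [gaussianCountLog, gaussianCount, gaussianCentralProb, pow_succ (N : ℝ) α]
  push_cast
  rw [← hP, hm]
  have e1 : 1 / P * (P * N) = N := by field_simp
  have e2 : (1 - 1 / P) * (P * N) = P * N - N := by rw [sub_mul, e1, one_mul]
  have e3 : (1 / P : ℝ) ^ (-(N : ℝ)) = P ^ N := by
    rw [rpow_neg (by positivity), rpow_natCast, one_div, inv_pow, inv_inv]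
  have e4 : √(3 / ((P * N) ^ 2 - 1)) = √3 * exp (-(log (1 - (1 / (P * N)) ^ 2) / 2)) / (P * N) := by
    have : 3 / ((P * N) ^ 2 - 1) = 3 / (1 - (1 / (P * N)) ^ 2) / (P * N) ^ 2 := by
      have h1 : (P * N) ^ 2 - 1 ≠ 0 := by nlinarith
      field_simp
    rw [this, sqrt_div (by positivity), sqrt_sq (by positivity), sqrt_div (by norm_num), exp_neg,
      ← log_sqrt hb2.le, exp_log (sqrt_pos.2 hb2)]
    ring
  have e5 : (1 - 1 / P) ^ (-(P * N - N)) =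
      exp (-(P * N - N + 1) * log (1 - 1 / P)) * (1 - 1 / P) := by
    calc (1 - 1 / P) ^ (-(P * N - N))
        = exp (-(P * N - N + 1) * log (1 - 1 / P) + log (1 - 1 / P)) := by
          rw [rpow_def_of_pos hb]; congr 1; ring
      _ = _ := by rw [exp_add, exp_log hb]
  have e6 : exp (-(P * N - N + 1) * log (1 - 1 / P) - N - log (1 - (1 / (P * N)) ^ 2) / 2) =
      exp (-(P * N - N + 1) * log (1 - 1 / P)) * exp (-(log (1 - (1 / (P * N)) ^ 2) / 2)) /
        exp 1 ^ N := by
    rw [← exp_nat_mul, mul_one, ← exp_add, ← exp_sub]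
    congr 1
    ring
  rw [e1, e2, e3, e4, e5, e6, mul_pow]
  have h3 : (0 : ℝ) < √3 := by positivity
  have hb' := hb.ne'
  have e7 : π * (1 / P) * (1 - 1 / P) * (P * N) = π * (1 - 1 / P) * N := by
    field_simp
  rw [e7]
  generalize 1 - 1 / P = c at *
  field_simp

/-- Only the term `-N / (2 N ^ (α - 1))` can be larger than `O(1 / N ^ 3)`, and it is so exactly for
`α = 4`. -/
theorem gaussianCountLog_isBigO {α : ℕ} (hα : 4 ≤ α) :
    (fun N : ℕ => gaussianCountLog α N + N / (N : ℝ) ^ (α - 1) / 2) =O[atTop]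
      fun N : ℕ => 1 / (N : ℝ) ^ 3 := by
  refine IsBigO.of_bound 8 ?_
  filter_upwards [eventually_ge_atTop 2] with N hN
  have hN2 : (2 : ℝ) ≤ N := by exact_mod_cast hN
  have hN0 : (0 : ℝ) < N := by linarith
  obtain ⟨b, hb⟩ : ∃ b : ℝ, b = 1 / (N : ℝ) ^ (α - 1) := ⟨_, rfl⟩
  have hb3 : b ≤ 1 / (N : ℝ) ^ 3 := by
    rw [hb]; gcongr
    · linarith
    · omega
  have hb0 : 0 < b := by rw [hb]; positivity
  have hNb : N * b ≤ 1 := by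
    calc N * b ≤ N * (1 / (N : ℝ) ^ 3) := by gcongr
      _ = 1 / (N : ℝ) ^ 2 := by field_simp
      _ ≤ 1 := by rw [div_le_one (by positivity)]; exact one_le_pow₀ (by linarith)
  have hb2 : b ≤ 1 / 2 := by nlinarith
  have hmb : (N : ℝ) ^ α * b = N := by
    rw [hb, natCast_pow_eq_mul (by omega : 1 ≤ α)]; field_simp
  have hM : 1 / (N : ℝ) ^ α = b / N := by
    rw [hb, natCast_pow_eq_mul (by omega : 1 ≤ α)]; field_simp
  have hl1 := abs_log_sub_add_sum_range_le (x := b) (by rw [abs_of_pos hb0]; linarith) 2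
  have hx : |(b / N) ^ 2| < 1 := by
    have : b / N ≤ 1 / 2 := (div_le_self hb0.le (by linarith)).trans hb2
    have : 0 < b / N := by positivity
    rw [abs_of_pos (by positivity)]
    nlinarith
  have hl2 := abs_log_sub_add_sum_range_le (x := (b / N) ^ 2) hx 0
  rw [abs_of_pos hb0] at hl1
  simp only [Finset.sum_range_succ, Finset.sum_range_zero] at hl1 hl2
  norm_num at hl1 hl2
  have hbN : (b / N) ^ 2 ≤ b / 2 := by
    have h1 : b / N ≤ b := div_le_self hb0.le (by linarith)
    have h2 : 0 < b / N := by positivity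
    nlinarith
  have hl2' : |log (1 - (b / N) ^ 2)| ≤ b := by
    refine hl2.trans ?_
    rw [div_le_iff₀ (by linarith)]
    nlinarith
  obtain ⟨r, hr⟩ : ∃ r, r = b + b ^ 2 / 2 + log (1 - b) := ⟨_, rfl⟩
  have hr1 : |r| ≤ 2 * b ^ 3 := by
    rw [hr]
    refine hl1.trans ?_
    rw [div_le_iff₀ (by linarith)]
    nlinarith [pow_pos hb0 3]
  have hM0 : 0 ≤ (N : ℝ) ^ α - N + 1 := by
    have : (N : ℝ) ≤ N ^ α := le_self_pow₀ (by linarith) (by omega)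
    linarith
  have hMr : |((N : ℝ) ^ α - N + 1) * r| ≤ 2 * b := by
    rw [abs_mul, abs_of_nonneg hM0]
    calc ((N : ℝ) ^ α - N + 1) * |r| ≤ (N : ℝ) ^ α * (2 * b ^ 3) := by
          gcongr; linarith
      _ = 2 * b * ((N : ℝ) ^ α * b * b) := by ring
      _ = 2 * b * (N * b) := by rw [hmb]
      _ ≤ 2 * b * 1 := by gcongr
      _ = 2 * b := mul_one _
  have hlog : log (1 - b) = r - b - b ^ 2 / 2 := by rw [hr]; ring
  have e : gaussianCountLog α N + N / (N : ℝ) ^ (α - 1) / 2 =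
      -(((N : ℝ) ^ α - N + 1) * r) + (b + b ^ 2 / 2 - N * b * b / 2) -
        log (1 - (b / N) ^ 2) / 2 := by
    have e1 : (N : ℝ) / (N : ℝ) ^ (α - 1) = N * b := by rw [hb]; ring
    rw [gaussianCountLog, e1, ← hb, hM, hlog]
    linear_combination (1 + b / 2) * hmb
  rw [e, norm_of_nonneg (by positivity : (0 : ℝ) ≤ 1 / (N : ℝ) ^ 3), Real.norm_eq_abs]
  have h5 : 0 ≤ N * b * b := by positivity
  have h6 : N * b * b ≤ 1 * b := by gcongr
  have h7 : b ^ 2 ≤ b := by nlinarith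
  have h8 := abs_le.1 hMr
  have h9 := abs_le.1 hl2'
  rw [abs_le]
  constructor <;> nlinarith

/-- The expansion of the number of magic series, where `q / N ^ 2` is the correction to the elementary
approximation of `gaussianCount α N`. -/
theorem magicSeriesCount_expansion {α : ℕ} {q : ℝ} (hα : 4 ≤ α)
    (hq : (fun N : ℕ => -((N : ℝ) / (N : ℝ) ^ (α - 1) / 2) - q * (1 / (N : ℝ)) ^ 2) =O[atTop]
      fun N : ℕ => 1 / (N : ℝ) ^ 3) :
    HasExpansion atTop (fun N : ℕ => 1 / (N : ℝ)) (fun N : ℕ => 1 / (N : ℝ) ^ 3)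
      (fun N : ℕ => (magicSeriesCount α N : ℝ) /
        (√3 / π * ((N : ℝ) ^ (α - 1) * exp 1) ^ N / (N : ℝ) ^ (α + 1)))
      (-(7 / 30)) (11 / 2520 + q) := by
  have h1 : HasExpansion atTop (fun N : ℕ => 1 / (N : ℝ)) (fun N : ℕ => 1 / (N : ℝ) ^ 3)
      (fun N : ℕ => (magicSeriesCount α N : ℝ) / gaussianCount α N) (-(7 / 30)) (11 / 2520) := by
    refine ((hasExpansion_ratio.comp_tendsto (tendsto_hypercube (by omega : 2 ≤ α))).trans
      (sparseErr_hypercube_isBigO (by omega : 3 ≤ α) le_rfl)).congr' ?_ EventuallyEq.rfl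
    filter_upwards [eventually_ge_atTop 2] with N hN
    rw [magicSeriesCount_div_gaussianCount (by omega) hN]
    rfl
  have h2 : HasExpansion atTop (fun N : ℕ => 1 / (N : ℝ)) (fun N : ℕ => 1 / (N : ℝ) ^ 3)
      (fun N : ℕ => exp (gaussianCountLog α N)) 0 (q + 0 ^ 2 / 2) := by
    refine isScale_nat.hasExpansion_exp (((gaussianCountLog_isBigO hα).add hq).congr_left ?_)
    intro N
    ring
  have h3 := isScale_nat.hasExpansion_mul h1 h2
  have e : 11 / 2520 + (q + 0 ^ 2 / 2) + -(7 / 30) * 0 = 11 / 2520 + q := by ring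
  rw [add_zero, e] at h3
  refine h3.congr' ?_ EventuallyEq.rfl
  filter_upwards [eventually_ge_atTop 2] with N hN
  have hg : gaussianCount α N ≠ 0 := by
    have h4 := gaussianCount_div (by omega : 2 ≤ α) hN
    intro h0
    rw [h0, zero_div] at h4
    exact (exp_pos _).ne h4
  rw [← gaussianCount_div (by omega) hN]
  field_simp

end MagicSeries

end

theorem mainTheorem4 :
    -- the expansion for `α = 4`
    ((fun N : ℕ => (MagicSeries.magicSeriesCount 4 N : ℝ) /
          (Real.sqrt 3 / Real.pi * ((N : ℝ) ^ 3 * Real.exp 1) ^ N / (N : ℝ) ^ 5)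
        - (1 - 7 / (30 * (N : ℝ)) - 1249 / (2520 * (N : ℝ) ^ 2)))
      =O[atTop] fun N : ℕ => 1 / (N : ℝ) ^ 3) ∧
    -- the expansion for every fixed `α > 4`
    (∀ α : ℕ, 4 < α →
      (fun N : ℕ => (MagicSeries.magicSeriesCount α N : ℝ) /
          (Real.sqrt 3 / Real.pi * ((N : ℝ) ^ (α - 1) * Real.exp 1) ^ N / (N : ℝ) ^ (α + 1))
        - (1 - 7 / (30 * (N : ℝ)) + 11 / (2520 * (N : ℝ) ^ 2)))
      =O[atTop] fun N : ℕ => 1 / (N : ℝ) ^ 3) ∧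
    -- the value of the first correction coefficient
    MagicSeries.K₁ = -7 / 30 ∧
    -- universality: the first correction to the Gaussian approximation of the central
    -- probability, whenever `β → 0` and `β m → ∞`
    (∀ (m : ℕ → ℕ) (β : ℕ → ℝ),
      Tendsto β atTop (𝓝 0) →
      Tendsto (fun k => β k * (m k : ℝ)) atTop atTop →
      (∀ k, ∃ A B : ℕ, β k * (m k : ℝ) = A ∧ β k * (m k : ℝ) * ((m k : ℝ) + 1) / 2 = B) →
      (fun k => MagicSeries.centralProb (m k) (β k) / MagicSeries.gaussianCentralProb (m k) (β k)
        - (1 + MagicSeries.K₁ / (β k * (m k : ℝ))))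
      =o[atTop] fun k => 1 / (β k * (m k : ℝ))) ∧
    -- in particular, the same first correction factor for hypercubes of every order `α ≥ 2`
    (∀ α : ℕ, 2 ≤ α →
      (fun N : ℕ => (MagicSeries.magicSeriesCount α N : ℝ) / MagicSeries.gaussianCount α N
        - (1 + MagicSeries.K₁ / (N : ℝ)))
      =O[atTop] fun N : ℕ => 1 / (N : ℝ) ^ 2) := by
  refine ⟨?_, fun α hα => ?_, MagicSeries.K₁_eq, MagicSeries.centralProb_isLittleO,
    fun α hα => ?_⟩
  · have h := MagicSeries.magicSeriesCount_expansion (α := 4) (q := -(1 / 2)) le_rfl (by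
      refine (isBigO_zero _ _).congr' ?_ EventuallyEq.rfl
      filter_upwards [eventually_gt_atTop 0] with N hN
      have : (N : ℝ) ≠ 0 := by exact_mod_cast hN.ne'
      norm_num
      field_simp
      norm_num)
    refine h.congr_left fun N => ?_
    norm_num
    ring
  · have h := MagicSeries.magicSeriesCount_expansion (α := α) (q := 0) (by omega) (by
      refine IsBigO.of_bound 1 ?_
      filter_upwards [eventually_gt_atTop 0] with N hN
      have h1 : (1 : ℝ) ≤ N := by exact_mod_cast hN
      have e : (N : ℝ) / (N : ℝ) ^ (α - 1) = 1 / (N : ℝ) ^ (α - 2) := by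
        rw [show α - 1 = α - 2 + 1 by omega, pow_succ]; field_simp
      have h2 : 1 / (N : ℝ) ^ (α - 2) ≤ 1 / (N : ℝ) ^ 3 := by
        gcongr
        omega
      have h3 : (0 : ℝ) ≤ 1 / (N : ℝ) ^ (α - 2) := by positivity
      rw [e, zero_mul, sub_zero, norm_neg, Real.norm_of_nonneg (by positivity),
        Real.norm_of_nonneg (by positivity)]
      linarith)
    refine h.congr_left fun N => ?_
    ring
  · have h1 := (MagicSeries.hasExpansion_ratio.comp_tendsto
      (MagicSeries.tendsto_hypercube hα)).trans
      (MagicSeries.sparseErr_hypercube_isBigO hα (by norm_num))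
    have h2 : (fun N : ℕ => 11 / 2520 * (1 / (N : ℝ) ^ 2)) =O[atTop] fun N : ℕ => 1 / (N : ℝ) ^ 2 :=
      (isBigO_refl _ _).const_mul_left _
    refine (h1.add h2).congr' ?_ EventuallyEq.rfl
    filter_upwards [eventually_ge_atTop 2] with N hN
    rw [MagicSeries.magicSeriesCount_div_gaussianCount hα hN, MagicSeries.K₁_eq]
    simp only [Function.comp]
    ring
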